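/- Let $K_n=([n],E_n)$ be the complete graph with node set $[n]=\{1,\dots,n\}$. For an integer $\ell\ge 0$ let $$P^{\ell}_{\mathrm{match}}(n)=\operatorname{conv}\{\chi(M)\in\{0,1\}^{E_n} : M\subseteq E_n \text{ a matching in } K_n,\ |M|=\ell\}\subseteq\mathbb{R}^{E_n},$$ where $\chi(M)$ is the characteristic vector of $M$. The symmetric group $S_n$ acts on $\mathbb{R}^{E_n}$ by permuting the nodes, $(\pi.x)_{\{v,w\}}=x_{\{\pi^{-1}(v),\pi^{-1}(w)\}}$, and $S_d$ acts on $\mathbb{R}^d$ by $(\sigma.y)_j=y_{\sigma^{-1}(j)}$. A subspace extension of $P^{\ell}_{\mathrm{match}}(n)$ with $d$ variables is a set $Q=L\cap\mathbb{R}^d_{\ge 0}$, where $L\subseteq\mathbb{R}^d$ is an affine subspace, together with an affine map $p:\mathbb{R}^d\to\mathbb{R}^{E_n}$ such that $p(Q)=P^{\ell}_{\mathrm{match}}(n)$. It is coordinate-symmetric if for every $\pi\in S_n$ there is a permutation $\varkappa_\pi\in S_d$ with $\varkappa_\pi.Q=Q$ and $p(\varkappa_\pi.y)=\pi.p(y)$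 for all $y\in Q$. **Theorem.** For every $n\ge 3$ and every odd $\ell\ge 1$ with $\ell\le n/2$, there exists no coordinate-symmetric subspace extension of $P^{\ell}_{\mathrm{match}}(n)$ with at most $\binom{n}{(\ell-1)/2}$ variables. -/

import Mathlib

/-- `E_n`, the edge set of the complete graph on the node set `Fin n`. -/
abbrev KEdge (n : ℕ) : Type := (SimpleGraph.completeGraph (Fin n)).edgeSet

/-- `M ⊆ E_n` is a matching in the complete graph: no two distinct edges share a node. -/
def IsEdgeMatching {n : ℕ} (M : Finset (KEdge n)) : Prop :=
  ∀ e ∈ M, ∀ f ∈ M, e ≠ f → ∀ v : Fin n, ¬ (v ∈ (e : Sym2 (Fin n)) ∧ v ∈ (f : Sym2 (Fin n)))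

/-- The set of all matchings with exactly `l` edges in the complete graph on `n` nodes. -/
def matchingsOfSize (l n : ℕ) : Set (Finset (KEdge n)) :=
  {M | IsEdgeMatching M ∧ M.card = l}

/-- The characteristic vector of `A ⊆ B` in `ℝ^B`. -/
noncomputable def charVec {B : Type*} (A : Finset B) : B → ℝ :=
  Set.indicator (A : Set B) 1

/-- The cardinality-`l` matching polytope of the complete graph on `n` nodes. -/
def matchingPolytope (l n : ℕ) : Set (KEdge n → ℝ) :=
  convexHull ℝ (charVec '' matchingsOfSize l n)

/-- Permutation of coordinates as an affine transformation: `(σ.y) j = y (σ⁻¹ j)`. -/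
noncomputable def coordPerm {B : Type*} (σ : Equiv.Perm B) : (B → ℝ) ≃ᵃ[ℝ] (B → ℝ) :=
  (LinearEquiv.funCongrLeft ℝ ℝ σ⁻¹).toAffineEquiv

@[simp] theorem coordPerm_apply {B : Type*} (σ : Equiv.Perm B) (y : B → ℝ) (j : B) :
    coordPerm σ y j = y (σ⁻¹ j) := rfl

/-- The permutation of the edges, `{v, w} ↦ {π v, π w}`, induced by a permutation of the nodes. -/
def edgePerm {n : ℕ} (π : Equiv.Perm (Fin n)) : Equiv.Perm (KEdge n) :=
  (SimpleGraph.Iso.completeGraph π).mapEdgeSet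

@[simp] theorem coe_edgePerm {n : ℕ} (π : Equiv.Perm (Fin n)) (e : KEdge n) :
    ((edgePerm π e : KEdge n) : Sym2 (Fin n)) = Sym2.map π e := rfl

/-- The group of affine transformations of `ℝ^{E_n}` induced by permuting the nodes of the
complete graph: its elements are the maps `π.x` with
`(π.x) {v, w} = x {π⁻¹ v, π⁻¹ w}`, for `π` a permutation of the nodes. -/
noncomputable def nodePermGroup (n : ℕ) : Subgroup ((KEdge n → ℝ) ≃ᵃ[ℝ] (KEdge n → ℝ)) where
  carrier := {g | ∃ π : Equiv.Perm (Fin n), g = coordPerm (edgePerm π)}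
  one_mem' := by
    refine ⟨1, ?_⟩
    have h : edgePerm (1 : Equiv.Perm (Fin n)) = 1 := by
      ext e : 2
      simp
    rw [h]
    rfl
  mul_mem' := by
    rintro _ _ ⟨π, rfl⟩ ⟨τ, rfl⟩
    refine ⟨π * τ, ?_⟩
    have h : edgePerm (π * τ) = edgePerm π * edgePerm τ := by
      ext e : 2
      simp [Sym2.map_map]
    rw [h]
    rfl
  inv_mem' := by
    rintro _ ⟨π, rfl⟩
    refine ⟨π⁻¹, ?_⟩
    have h : edgePerm π⁻¹ = (edgePerm π)⁻¹ := by
      rw [eq_inv_iff_mul_eq_one]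
      ext e : 2
      simp [Sym2.map_map]
    rw [h]
    rfl

/-- `Q ⊆ ℝ^d` together with the affine map `p` is a subspace extension of `P`: `Q` is the
intersection of an affine subspace with the nonnegative orthant (in particular, `Q` is a
polyhedron), and `p(Q) = P`. -/
def IsSubspaceExtension {B : Type*} {d : ℕ} (P : Set (B → ℝ)) (Q : Set (Fin d → ℝ))
    (p : (Fin d → ℝ) →ᵃ[ℝ] (B → ℝ)) : Prop :=
  (∃ L : AffineSubspace ℝ (Fin d → ℝ), Q = {y | y ∈ L ∧ ∀ j, 0 ≤ y j}) ∧ p '' Q = P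

/-- The extension `Q ⊆ ℝ^d` with projection `p` is coordinate-symmetric with respect to the
group `G` of affine transformations: for every `g ∈ G` there is a permutation `σ` of the `d`
coordinates with `σ.Q = Q` and `p(σ.y) = g.p(y)` for all `y ∈ Q`. -/
def IsCoordinateSymmetric {B : Type*} {d : ℕ} (G : Subgroup ((B → ℝ) ≃ᵃ[ℝ] (B → ℝ)))
    (Q : Set (Fin d → ℝ)) (p : (Fin d → ℝ) →ᵃ[ℝ] (B → ℝ)) : Prop :=
  ∀ g ∈ G, ∃ σ : Equiv.Perm (Fin d),
    coordPerm σ '' Q = Q ∧ ∀ y ∈ Q, p (coordPerm σ y) = g (p y)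

/-! Write `l = 2 * k + 1` and suppose a symmetric extension `Q` has at most `n.choose k` variables.
Averaging over the symmetries gives an equivariant section `s` of `p` over the vertices
(`exists_equivariant_section`). Each coordinate of `s` is then invariant under a group of node
permutations of index at most `n.choose k`. Apart from one exception on six nodes, such a group
contains every even permutation that fixes some set `W` of at most `k` nodes
(`Equiv.Perm.exists_finset_forall_even_mem`). Hence, among matchings of size `l` covering the same
nodes, that coordinate depends only on the edges that meet `W`.

Take two disjoint node sets of odd size `2 * k + 1`, and average `s` over the perfect matchings of
their union with exactly `2 * t + 1` crossing edges, for `t = 0, ..., k`. The proportion of these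
matchings having a given trace on `W` is a polynomial in `t` of degree at most `k`
(`exists_polynomial_card_membersContaining`). Lagrange weights therefore extrapolate the averages to
`t = -1/2`, that is, to no crossing edges. The extrapolated point stays in the affine space, and its
coordinates stay nonnegative because the extrapolated proportions are nonnegative
(`sum_average_nonneg`), so it lies in `Q`. Its projection puts total weight `2 * k + 1` on edges
inside the two odd sets, while the odd-set inequalities allow only `2 * k`
(`not_forall_even_invariant`).

Two cases are separate: for `k = 0` the section would be invariant under all even permutations, and
for `n = 6`, `k = 1` a dimension count suffices. -/

/-! ### Binomial and factorial estimates -/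

theorem Nat.choose_lt_choose_succ_of_two_mul_lt {n k : ℕ} (h : 2 * k + 1 < n) :
    n.choose k < n.choose (k + 1) := by
  have h1 := Nat.choose_succ_right_eq n k
  have h2 : 0 < n.choose k := Nat.choose_pos (by omega)
  have h3 : k + 2 ≤ n - k := by omega
  by_contra! h4
  have h5 : n.choose k * (k + 2) ≤ n.choose k * (n - k) := Nat.mul_le_mul_left _ h3
  have h6 : n.choose (k + 1) * (k + 1) ≤ n.choose k * (k + 1) := Nat.mul_le_mul_right _ h4
  nlinarith

theorem Nat.choose_lt_choose_of_two_mul_le {n k j : ℕ} (hkj : k < j) (hj : 2 * j ≤ n) :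
    n.choose k < n.choose j := by
  induction j, hkj using Nat.le_induction with
  | base => exact Nat.choose_lt_choose_succ_of_two_mul_lt (by omega)
  | succ j hj' ih =>
    exact (ih (by omega)).trans (Nat.choose_lt_choose_succ_of_two_mul_lt (by omega))

theorem Nat.choose_lt_choose_of_lt_of_add_lt {n k j : ℕ} (hkj : k < j) (hj : k + j < n) :
    n.choose k < n.choose j := by
  rcases Nat.le_total (2 * j) n with h | h
  · exact Nat.choose_lt_choose_of_two_mul_le hkj h
  · rw [← Nat.choose_symm (show j ≤ n by omega)]
    exact Nat.choose_lt_choose_of_two_mul_le (by omega) (by omega)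

/-- Used against primitive groups. For large `n` one has `n.choose k ≤ 2 ^ n ≤ 4 ^ d < d!`, the last
step from `d = 9` on; the smaller `n` are checked. At `n = 6`, `k = 1`, `d = 3` both sides equal 6,
hence `7 ≤ n`. -/
theorem Nat.choose_lt_factorial_of_le_two_mul {n k d : ℕ} (hn : 7 ≤ n) (hk : 4 * k + 2 ≤ n)
    (hd : n ≤ 2 * d) : n.choose k < d.factorial := by
  rcases Nat.lt_or_ge n 18 with h | h
  · refine lt_of_lt_of_le ?_ (Nat.factorial_le (show (n + 1) / 2 ≤ d by omega))
    have hk' : k ≤ 3 := by omega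
    clear hd
    interval_cases n <;> interval_cases k <;> first | decide | omega
  · have h1 : ∀ m, 9 ≤ m → 2 ^ (2 * m) < m.factorial := by
      intro m hm
      induction m, hm using Nat.le_induction with
      | base => decide
      | succ m hm ih =>
        rw [Nat.factorial_succ, Nat.mul_succ, pow_add]
        nlinarith [Nat.factorial_pos m]
    exact ((Nat.choose_le_two_pow n k).trans (Nat.pow_le_pow_right (by norm_num) hd)).trans_lt
      (h1 d (by omega))

/-- Each new factor satisfies `m + j + 1 ≥ (r + 1) * (j + 1)`, because `m = r * c ≥ r * (j + 1)`. -/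
theorem Nat.factorial_mul_pow_mul_factorial_le (m c r : ℕ) (hm : m = r * c) :
    m.factorial * ((r + 1) ^ c * c.factorial) ≤ (m + c).factorial := by
  have key : ∀ j, j ≤ c → m.factorial * ((r + 1) ^ j * j.factorial) ≤ (m + j).factorial := by
    intro j
    induction j with
    | zero => simp
    | succ j ih =>
      intro hj
      have h1 := ih (by omega)
      have h2 : (r + 1) * (j + 1) ≤ m + j + 1 := by
        subst hm
        nlinarith
      calc m.factorial * ((r + 1) ^ (j + 1) * (j + 1).factorial)
          = ((r + 1) * (j + 1)) * (m.factorial * ((r + 1) ^ j * j.factorial)) := by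
            rw [Nat.factorial_succ]; ring
        _ ≤ (m + j + 1) * (m + j).factorial := Nat.mul_le_mul h2 h1
        _ = (m + (j + 1)).factorial := by rw [← Nat.factorial_succ]; rfl
  exact key c le_rfl

theorem Nat.two_pow_mul_factorial_pow_le_step {r c : ℕ} (hr : 3 ≤ r) (hc : 2 ≤ c)
    (h : 2 ^ (r * c) * (c.factorial ^ r * r.factorial) ≤ (r * c).factorial) :
    2 ^ ((r + 1) * c) * (c.factorial ^ (r + 1) * (r + 1).factorial) ≤
      ((r + 1) * c).factorial := by
  have h1 := Nat.factorial_mul_pow_mul_factorial_le (r * c) c r rfl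
  have h2 : 2 ^ c * (r + 1) ≤ (r + 1) ^ c := by
    obtain ⟨c, rfl⟩ : ∃ d, c = d + 2 := ⟨c - 2, by omega⟩
    have h3 : 2 ^ c * 4 ≤ (r + 1) ^ c * (r + 1) :=
      Nat.mul_le_mul (Nat.pow_le_pow_left (by omega) c) (by omega)
    calc 2 ^ (c + 2) * (r + 1) = (2 ^ c * 4) * (r + 1) := by ring
      _ ≤ ((r + 1) ^ c * (r + 1)) * (r + 1) := Nat.mul_le_mul_right _ h3
      _ = (r + 1) ^ (c + 2) := by ring
  calc 2 ^ ((r + 1) * c) * (c.factorial ^ (r + 1) * (r + 1).factorial)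
      = (2 ^ (r * c) * (c.factorial ^ r * r.factorial)) * ((2 ^ c * (r + 1)) * c.factorial) := by
        rw [Nat.factorial_succ]; ring
    _ ≤ (r * c).factorial * ((r + 1) ^ c * c.factorial) :=
        Nat.mul_le_mul h (Nat.mul_le_mul_right _ h2)
    _ ≤ (r * c + c).factorial := h1
    _ = ((r + 1) * c).factorial := by rw [Nat.succ_mul]

/-- The stabilizer of a partition into `r` blocks of size `c` has order `c! ^ r * r!`, so its index
is at least `2 ^ (r * c)`. The inequality fails for `c = 2` and `r = 4, 5`, which `hrc` excludes. -/
theorem Nat.two_pow_mul_factorial_pow_le {r c : ℕ} (hr : 4 ≤ r) (hc : 2 ≤ c)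
    (hrc : 3 ≤ c ∨ 6 ≤ r) :
    2 ^ (r * c) * (c.factorial ^ r * r.factorial) ≤ (r * c).factorial := by
  have four : ∀ c, 3 ≤ c → 2 ^ (4 * c) * (c.factorial ^ 4 * 24) ≤ (4 * c).factorial := by
    intro c hc
    induction c, hc using Nat.le_induction with
    | base => decide
    | succ c hc ih =>
      have h : 16 * (c + 1) ^ 4 ≤ (4 * c + 4) * (4 * c + 3) * (4 * c + 2) * (4 * c + 1) := by
        nlinarith [sq_nonneg c]
      calc 2 ^ (4 * (c + 1)) * ((c + 1).factorial ^ 4 * 24)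
          = (16 * (c + 1) ^ 4) * (2 ^ (4 * c) * (c.factorial ^ 4 * 24)) := by
            rw [Nat.factorial_succ]; ring
        _ ≤ _ := Nat.mul_le_mul h ih
        _ = (4 * (c + 1)).factorial := by
            rw [show 4 * (c + 1) = 4 * c + 1 + 1 + 1 + 1 by ring]
            simp only [Nat.factorial_succ]
            ring
  rcases hrc with h | h
  · induction r, hr using Nat.le_induction with
    | base => exact four c h
    | succ r hr ih => exact Nat.two_pow_mul_factorial_pow_le_step (by omega) hc ih
  · rcases Nat.lt_or_ge c 3 with h3 | h3
    · obtain rfl : c = 2 := by omega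
      induction r, h using Nat.le_induction with
      | base => decide
      | succ r hr ih => exact Nat.two_pow_mul_factorial_pow_le_step (by omega) hc (ih (by omega))
    · induction r, hr using Nat.le_induction with
      | base => exact four c h3
      | succ r hr ih =>
        rcases Nat.lt_or_ge r 6 with h6 | h6
        · have h5 : r = 5 := by omega
          subst h5
          exact Nat.two_pow_mul_factorial_pow_le_step (by omega) hc
            (Nat.two_pow_mul_factorial_pow_le_step (by omega) hc (four c h3))
        · exact Nat.two_pow_mul_factorial_pow_le_step (by omega) hc (ih h6)

/-- Used against imprimitive groups. For two blocks the index is half a central binomial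
coefficient, so a factor of 2 has to be gained between `choose k` and `choose (k + 1)`. For three
blocks `(2 * c).choose c ≥ 6` absorbs the `3!`. -/
theorem Nat.choose_mul_factorial_pow_lt {n k r c : ℕ} (hk : 1 ≤ k) (hn : 7 ≤ n)
    (hkn : 4 * k + 2 ≤ n) (hr : 2 ≤ r) (hc : 2 ≤ c) (h : r * c = n) :
    n.choose k * (c.factorial ^ r * r.factorial) < n.factorial := by
  subst h
  have hpos : 0 < c.factorial := c.factorial_pos
  rcases Nat.lt_or_ge r 4 with h4 | h4
  · interval_cases r
    · have h1 := Nat.choose_mul_factorial_mul_factorial (show c ≤ 2 * c by omega)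
      rw [show 2 * c - c = c by omega] at h1
      have h2 := Nat.choose_succ_right_eq (2 * c) k
      have h3 : 2 * (2 * c).choose k < (2 * c).choose (k + 1) := by
        have h5 : 0 < (2 * c).choose k := Nat.choose_pos (by omega)
        have h6 : 2 * (k + 1) + 1 ≤ 2 * c - k := by omega
        by_contra! h7
        have h8 := Nat.mul_le_mul_left ((2 * c).choose k) h6
        have h9 := Nat.mul_le_mul_right (k + 1) h7
        nlinarith
      have h4 : (2 * c).choose (k + 1) ≤ (2 * c).choose c := by
        simpa using Nat.choose_le_middle (k + 1) (2 * c)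
      rw [← h1]
      have h5 : 0 < c.factorial * c.factorial := Nat.mul_pos hpos hpos
      calc (2 * c).choose k * (c.factorial ^ 2 * 2)
          = (2 * (2 * c).choose k) * (c.factorial * c.factorial) := by ring
        _ < (2 * c).choose c * (c.factorial * c.factorial) :=
            Nat.mul_lt_mul_of_pos_right (by omega) h5
        _ = _ := by ring
    · have h1 := Nat.choose_mul_factorial_mul_factorial (show c ≤ 3 * c by omega)
      have h2 := Nat.choose_mul_factorial_mul_factorial (show c ≤ 2 * c by omega)
      rw [show 3 * c - c = 2 * c by omega] at h1
      rw [show 2 * c - c = c by omega] at h2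
      have h3 : (3 * c).choose k < (3 * c).choose c :=
        Nat.choose_lt_choose_of_lt_of_add_lt (by omega) (by omega)
      have h4 : 6 ≤ (2 * c).choose c := by
        calc 6 = (2 * 2).choose 2 := by decide
          _ ≤ (2 * c).choose 2 := Nat.choose_le_choose _ (by omega)
          _ ≤ _ := by simpa using Nat.choose_le_middle 2 (2 * c)
      rw [← h1, ← h2]
      have h5 : 0 < c.factorial ^ 3 := by positivity
      calc (3 * c).choose k * (c.factorial ^ 3 * 6)
          = (3 * c).choose k * 6 * c.factorial ^ 3 := by ring
        _ < (3 * c).choose c * (2 * c).choose c * c.factorial ^ 3 := by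
            refine Nat.mul_lt_mul_of_pos_right ?_ h5
            exact Nat.mul_lt_mul_of_lt_of_le h3 h4 (by omega)
        _ = _ := by ring
  · by_cases h6 : 3 ≤ c ∨ 6 ≤ r
    · have h1 := Nat.two_pow_mul_factorial_pow_le h4 hc h6
      refine lt_of_lt_of_le (Nat.mul_lt_mul_of_pos_right ?_ (by positivity)) h1
      calc (r * c).choose k < (r * c).choose (k + 1) :=
            Nat.choose_lt_choose_succ_of_two_mul_lt (by omega)
        _ ≤ _ := Nat.choose_le_two_pow _ _
    · obtain rfl : c = 2 := by omega
      have : r = 4 ∨ r = 5 := by omega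
      have hk2 : k ≤ 2 := by omega
      rcases this with rfl | rfl <;> interval_cases k <;> decide

/-! ### Permutation groups of small index -/

-- Splitting `swap c (x c)` off `x` leaves a permutation disjoint from `y`. So the commutator of `x`
-- and `y` equals that of this transposition and `y`, a product of two transpositions sharing the
-- point `x c`.
open Equiv MulAction Pointwise in
theorem Equiv.Perm.isThreeCycle_commutator {α : Type*} [Fintype α] [DecidableEq α]
    {x y : Perm α} {c : α} (hx : x c ≠ c) (hy : y c ≠ c)
    (h : ∀ a, x a ≠ a → y a ≠ a → a = c) : (x * y * x⁻¹ * y⁻¹).IsThreeCycle := by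
  have hxc : x (x c) ≠ x c := fun h' => hx (x.injective h')
  have hyxc : y (x c) = x c := by
    by_contra h'
    exact hx (h _ hxc h')
  have hyne : y c ≠ x c := fun h' => hx (y.injective (hyxc.trans h'.symm))
  have hdisj : Perm.Disjoint (swap c (x c) * x) y := by
    intro v
    by_cases hv : y v = v
    · exact Or.inr hv
    · left
      by_cases hvc : v = c
      · subst hvc
        simp
      · have hxv : x v = v := by
          by_contra h'
          exact hvc (h v h' hv)
        have hvx : v ≠ x c := fun h' => hv (by rw [h', hyxc])
        simp [hxv, swap_apply_of_ne_of_ne hvc hvx]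
  have hcomm := hdisj.commute.eq
  have hconj : x * y * x⁻¹ = swap c (x c) * y * swap c (x c) := by
    have h1 : x = swap c (x c) * (swap c (x c) * x) := by simp
    calc x * y * x⁻¹ = swap c (x c) * ((swap c (x c) * x) * y) * x⁻¹ := by simp [mul_assoc]
      _ = _ := by rw [hcomm]; simp [mul_assoc]
  have hsw : y * swap c (x c) * y⁻¹ = swap (y c) (x c) := by
    conv_rhs => rw [← hyxc]
    exact (Equiv.swap_apply_apply y c (x c)).symm
  have : x * y * x⁻¹ * y⁻¹ = swap (x c) c * swap (x c) (y c) := by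
    rw [hconj, mul_assoc, mul_assoc, ← mul_assoc y, hsw, swap_comm c, swap_comm (y c)]
  rw [this]
  exact Perm.isThreeCycle_swap_mul_swap_same hx hyne.symm hy.symm

open Equiv in
/-- Bochert's dichotomy: a permutation group contains a three-cycle, or it meets trivially the
symmetric group of some set containing at least half of the points. -/
theorem Equiv.Perm.exists_isThreeCycle_or_exists_finset {α : Type*} [Fintype α] [DecidableEq α]
    (U : Subgroup (Perm α)) :
    (∃ g ∈ U, g.IsThreeCycle) ∨
      ∃ D : Finset α, Fintype.card α ≤ 2 * D.card ∧
        ∀ g ∈ U, (∀ a ∉ D, g a = a) → g = 1 := by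
  classical
  let 𝒟 : Finset (Finset α) :=
    Finset.univ.filter fun D => ∀ g ∈ U, (∀ a ∉ D, g a = a) → g = 1
  have hne : 𝒟.Nonempty := ⟨∅, by
    simp only [𝒟, Finset.mem_filter, Finset.mem_univ, true_and]
    intro g _ hg
    ext a
    exact hg a (by simp)⟩
  -- If the largest `D` has fewer than half of the points, then `Dᶜ` and `insert c D` are both too
  -- large for `𝒟`. They yield nontrivial elements of `U` supported there, and these supports meet
  -- only in `c`.
  obtain ⟨D, hD, hmax⟩ := Finset.exists_max_image 𝒟 Finset.card hne
  have hDU : ∀ g ∈ U, (∀ a ∉ D, g a = a) → g = 1 := by simpa [𝒟] using hD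
  by_cases hcard : Fintype.card α ≤ 2 * D.card
  · exact Or.inr ⟨D, hcard, hDU⟩
  left
  have hc : Dᶜ ∉ 𝒟 := by
    intro h
    have := hmax _ h
    rw [Finset.card_compl] at this
    omega
  simp only [𝒟, Finset.mem_filter, Finset.mem_univ, true_and, not_forall] at hc
  obtain ⟨x, hxU, hxD, hx1⟩ := hc
  obtain ⟨c, hxc⟩ : ∃ c, x c ≠ c := by
    by_contra! h
    exact hx1 (Equiv.ext h)
  have hcD : c ∉ D := fun h => hxc (hxD c (by simpa using h))
  have hc' : insert c D ∉ 𝒟 := by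
    intro h
    have := hmax _ h
    rw [Finset.card_insert_of_notMem hcD] at this
    omega
  simp only [𝒟, Finset.mem_filter, Finset.mem_univ, true_and, not_forall] at hc'
  obtain ⟨y, hyU, hyD, hy1⟩ := hc'
  have hyc : y c ≠ c := by
    intro h
    refine hy1 (hDU y hyU fun a ha => ?_)
    by_cases hac : a = c
    · rw [hac, h]
    · exact hyD a (by simp [hac, ha])
  refine ⟨x * y * x⁻¹ * y⁻¹, U.mul_mem (U.mul_mem (U.mul_mem hxU hyU) (U.inv_mem hxU))
    (U.inv_mem hyU), Perm.isThreeCycle_commutator hxc hyc ?_⟩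
  intro a hxa hya
  by_contra hac
  have h1 : a ∉ D := fun h => hxa (hxD a (by simpa using h))
  exact hya (hyD a (by simp [hac, h1]))

-- The symmetric group of `D` meets `U` trivially, so products of their elements are pairwise
-- distinct.
open Equiv in
theorem Equiv.Perm.factorial_mul_card_le {α : Type*} [Fintype α] [DecidableEq α]
    (U : Subgroup (Perm α)) (D : Finset α) (h : ∀ g ∈ U, (∀ a ∉ D, g a = a) → g = 1) :
    D.card.factorial * Nat.card U ≤ (Fintype.card α).factorial := by
  classical
  have h1 : Nat.card (Perm D × U) = D.card.factorial * Nat.card U := by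
    rw [Nat.card_prod, Nat.card_eq_fintype_card, Fintype.card_perm, Fintype.card_coe]
  rw [← h1, ← Fintype.card_perm, ← Nat.card_eq_fintype_card]
  refine Nat.card_le_card_of_injective
    (fun p => Perm.ofSubtype p.1 * (p.2 : Perm α)) ?_
  rintro ⟨a, u⟩ ⟨b, v⟩ hab
  simp only at hab
  have h2 : (u : Perm α) * (v : Perm α)⁻¹ = Perm.ofSubtype (a⁻¹ * b) := by
    rw [map_mul, map_inv, eq_inv_mul_iff_mul_eq, ← mul_assoc, hab, mul_assoc, mul_inv_cancel,
      mul_one]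
  have h3 : (u : Perm α) * (v : Perm α)⁻¹ = 1 := by
    refine h _ (U.mul_mem u.2 (U.inv_mem v.2)) fun x hx => ?_
    rw [h2]
    exact Perm.ofSubtype_apply_of_not_mem _ hx
  have h4 : a⁻¹ * b = 1 := by
    apply Perm.ofSubtype_injective
    rw [← h2, h3, map_one]
  rw [mul_inv_eq_one] at h3
  rw [inv_mul_eq_one] at h4
  exact Prod.ext h4 (Subtype.ext h3)

theorem MonoidHom.natCard_le_mul_natCard_ker {G H : Type*} [Group G] [Group H] [Finite H]
    (φ : G →* H) : Nat.card G ≤ Nat.card H * Nat.card φ.ker := by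
  rw [← Subgroup.index_mul_card φ.ker, Subgroup.index_ker]
  exact Nat.mul_le_mul_right _ (Subgroup.card_le_card_group φ.range)

-- `U` permutes the translates of `B`, and the kernel of that action preserves each translate; the
-- two factors bound the kernel and the image.
open Equiv MulAction Pointwise in
theorem Equiv.Perm.card_le_of_isBlock {α : Type*} [Fintype α] [DecidableEq α]
    (U : Subgroup (Perm α)) [IsPretransitive U α] {B : Set α} (hB : IsBlock U B)
    (hne : B.Nonempty) :
    Nat.card U ≤ B.ncard.factorial ^ (orbit U B).ncard * (orbit U B).ncard.factorial := by
  classical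
  let φ := toPermHom U (orbit U B)
  have h1 := φ.natCard_le_mul_natCard_ker
  have hsys : ∀ a : α, ∃! C, C ∈ Set.range (fun g : U => g • B) ∧ a ∈ C :=
    (hB.isBlockSystem hne).1.2
  have horb : ∀ a : α, ∃ C : orbit U B, a ∈ (C : Set α) := fun a => by
    obtain ⟨C, ⟨hC, haC⟩, -⟩ := hsys a
    exact ⟨⟨C, hC⟩, haC⟩
  have huniq : ∀ (a : α) (C D : orbit U B), a ∈ (C : Set α) → a ∈ (D : Set α) → C = D := by
    intro a C D hC hD
    exact Subtype.ext ((hsys a).unique ⟨C.2, hC⟩ ⟨D.2, hD⟩)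
  choose f hf using horb
  have hker : Nat.card φ.ker ≤ Nat.card {g : Perm α // f ∘ g = f} := by
    refine Nat.card_le_card_of_injective
      (fun u => ⟨((u : U) : Perm α), ?_⟩) ?_
    · funext a
      have h2 : φ (u : U) (f a) = f a := by rw [(MonoidHom.mem_ker).1 u.2]; rfl
      have h3 : (((u : U) • (f a) : orbit U B) : Set α) = f a := congrArg Subtype.val h2
      refine huniq (((u : U) : Perm α) a) _ _ (hf _) ?_
      rw [← h3]
      exact Set.smul_mem_smul_set (a := (u : U)) (hf a)
    · intro u v huv
      exact Subtype.ext (Subtype.ext (Subtype.mk.inj huv))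
  have hfib : ∀ C : orbit U B, Fintype.card {a // f a = C} = B.ncard := by
    rintro ⟨C, hC⟩
    have hset : {a | f a = ⟨C, hC⟩} = C := by
      ext a
      refine ⟨fun h => ?_, fun h => huniq a _ _ (hf a) h⟩
      have h2 := hf a
      rw [show f a = ⟨C, hC⟩ from h] at h2
      exact h2
    have h5 : Nat.card {a // f a = ⟨C, hC⟩} = Set.ncard {a | f a = ⟨C, hC⟩} :=
      Nat.card_coe_set_eq _
    rw [← Nat.card_eq_fintype_card, h5, hset]
    obtain ⟨g, rfl⟩ := hC
    exact Set.ncard_smul_set g B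
  have hst := DomMulAct.stabilizer_card f
  rw [Finset.prod_congr rfl (fun C _ => by rw [hfib C]), Finset.prod_const, Finset.card_univ,
    ← Nat.card_eq_fintype_card, ← Nat.card_eq_fintype_card, Nat.card_coe_set_eq] at hst
  have hperm : Nat.card (Perm (orbit U B)) = (orbit U B).ncard.factorial := by
    rw [Nat.card_perm, Nat.card_coe_set_eq]
  rw [hperm] at h1
  rw [hst] at hker
  calc _ ≤ _ := h1
    _ ≤ _ := Nat.mul_le_mul_left _ hker
    _ = _ := mul_comm _ _

-- A primitive group with a three-cycle contains the alternating group by Jordan. A primitive group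
-- without one has index at least `d!` with `2 * d ≥ n` by Bochert's dichotomy, and an imprimitive
-- group is bounded through its blocks; both contradict `hU`.
open Equiv MulAction Pointwise in
theorem Equiv.Perm.alternatingGroup_le_of_factorial_le {α : Type*} [Fintype α] [DecidableEq α]
    (U : Subgroup (Perm α)) [IsPretransitive U α] {k : ℕ} (hk : 1 ≤ k)
    (hn : 7 ≤ Fintype.card α) (hkn : 4 * k + 2 ≤ Fintype.card α)
    (hU : (Fintype.card α).factorial ≤ (Fintype.card α).choose k * Nat.card U) :
    alternatingGroup α ≤ U := by
  classical
  have hUpos : 0 < Nat.card U := Nat.card_pos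
  by_cases hprim : IsPreprimitive U α
  · rcases Perm.exists_isThreeCycle_or_exists_finset U with ⟨g, hg, h3⟩ | ⟨D, hD, hDU⟩
    · exact Perm.alternatingGroup_le_of_isPreprimitive_of_isThreeCycle_mem hprim h3 hg
    · exfalso
      have h1 := Perm.factorial_mul_card_le U D hDU
      have h2 := Nat.choose_lt_factorial_of_le_two_mul hn hkn hD
      have h3 := Nat.mul_lt_mul_of_pos_right h2 hUpos
      omega
  · exfalso
    obtain ⟨B, hB, hBt⟩ : ∃ B : Set α, IsBlock U B ∧ ¬ IsTrivialBlock B := by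
      by_contra! h
      exact hprim ⟨fun {B} hB => h B hB⟩
    rw [IsTrivialBlock, not_or, Set.not_subsingleton_iff] at hBt
    have hne : B.Nonempty := hBt.1.nonempty
    have h1 := Perm.card_le_of_isBlock U hB hne
    have h2 := hB.ncard_block_mul_ncard_orbit_eq hne
    rw [Nat.card_eq_fintype_card] at h2
    have hc : 2 ≤ B.ncard := (Set.one_lt_ncard_iff_nontrivial).2 hBt.1
    have hr : 2 ≤ (orbit U B).ncard := by
      by_contra! h
      have h3 : B.ncard = Fintype.card α := by
        interval_cases (orbit U B).ncard <;> omega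
      apply hBt.2
      rw [← Nat.card_eq_fintype_card, ← Set.ncard_univ] at h3
      exact Set.eq_of_subset_of_ncard_le (Set.subset_univ _) h3.ge
    have h3 := Nat.choose_mul_factorial_pow_lt hk hn hkn hr hc ((mul_comm _ _).trans h2)
    have h4 := Nat.mul_le_mul_left ((Fintype.card α).choose k) h1
    omega

open Equiv in
theorem Equiv.Perm.card_le_of_invariant {α : Type*} [Fintype α] [DecidableEq α]
    (U : Subgroup (Perm α)) (S : Finset α) (hS : ∀ g ∈ U, ∀ a, g a ∈ S ↔ a ∈ S) :
    Nat.card U ≤ S.card.factorial * (Fintype.card α - S.card).factorial := by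
  classical
  have hst := DomMulAct.stabilizer_card (fun a : α => decide (a ∈ S))
  have h1 : Fintype.card {a // decide (a ∈ S) = true} = S.card := by
    simp
  have h2 : Fintype.card {a // decide (a ∈ S) = false} = Fintype.card α - S.card := by
    rw [← Finset.card_compl, Fintype.card_subtype]
    congr 1
    ext a
    simp
  rw [Fintype.prod_bool, h1, h2, ← Nat.card_eq_fintype_card] at hst
  rw [← hst]
  refine Nat.card_le_card_of_injective (fun u => ⟨(u : Perm α), ?_⟩) ?_
  · funext a
    simp [hS u u.2 a]
  · intro u v huv
    exact Subtype.ext (Subtype.mk.inj huv)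

-- Restriction to `W` has image in the symmetric group of `W`, and its kernel consists of
-- permutations supported off `W`.
open Equiv in
theorem Equiv.Perm.card_le_mul_card_comap_ofSubtype {α : Type*} [Fintype α] [DecidableEq α]
    (U : Subgroup (Perm α)) (W : Finset α) (hW : ∀ g ∈ U, ∀ a, g a ∈ W ↔ a ∈ W) :
    Nat.card U ≤ W.card.factorial *
      Nat.card (U.comap (Perm.ofSubtype : Perm {a // a ∉ W} →* Perm α)) := by
  classical
  let φ : U →* Perm {a // a ∈ W} :=
    { toFun := fun u => (u : Perm α).subtypePerm (hW u u.2)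
      map_one' := by ext; rfl
      map_mul' := fun _ _ => by ext; rfl }
  have h1 := φ.natCard_le_mul_natCard_ker
  have h2 : Nat.card (Perm {a // a ∈ W}) = W.card.factorial := by
    rw [Nat.card_perm, Nat.card_eq_fintype_card, Fintype.card_coe]
  rw [h2] at h1
  refine h1.trans (Nat.mul_le_mul_left _ ?_)
  have hfix : ∀ u : φ.ker, ∀ a ∈ W, ((u : U) : Perm α) a = a := by
    intro u a ha
    have h3 : φ u = 1 := u.2
    exact congrArg Subtype.val (DFunLike.congr_fun h3 ⟨a, ha⟩)
  have hof : ∀ u : φ.ker, Perm.ofSubtype (((u : U) : Perm α).subtypePerm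
      (fun a => not_congr (hW (u : U) (u : U).2 a)) : Perm {a // a ∉ W}) = ((u : U) : Perm α) :=
    fun u => Perm.ofSubtype_subtypePerm _ fun a ha hmem => ha (hfix u a hmem)
  refine Nat.card_le_card_of_injective (fun u => ⟨((u : U) : Perm α).subtypePerm
      (fun a => not_congr (hW (u : U) (u : U).2 a)), ?_⟩) ?_
  · rw [Subgroup.mem_comap, hof]
    exact (u : U).2
  · intro u v huv
    refine Subtype.ext (Subtype.ext ?_)
    rw [← hof u, ← hof v]
    exact congrArg _ (Subtype.mk.inj huv)

-- An invariant set of size `s` forces index at least `n.choose s`, so it or its complement has at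
-- most `k` points. This is applied to an orbit.
open Equiv MulAction in
theorem Equiv.Perm.exists_invariant_finset {α : Type*} [Fintype α] [DecidableEq α]
    (U : Subgroup (Perm α)) {k : ℕ}
    (hU : (Fintype.card α).factorial ≤ (Fintype.card α).choose k * Nat.card U)
    (htr : ¬ IsPretransitive U α) :
    ∃ W : Finset α, 1 ≤ W.card ∧ W.card ≤ k ∧ ∀ g ∈ U, ∀ a, g a ∈ W ↔ a ∈ W := by
  classical
  have hinv : ∀ S : Finset α, (∀ g ∈ U, ∀ a, g a ∈ S ↔ a ∈ S) →
      S.card ≤ k ∨ Fintype.card α - S.card ≤ k := by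
    intro S hS
    by_contra! hlt
    have h1 := Perm.card_le_of_invariant U S hS
    have h2 : (Fintype.card α).choose k < (Fintype.card α).choose S.card :=
      Nat.choose_lt_choose_of_lt_of_add_lt hlt.1 (by omega)
    have h3 := Nat.choose_mul_factorial_mul_factorial (Finset.card_le_univ S)
    rw [mul_assoc] at h3
    have h4 := Nat.mul_le_mul_left ((Fintype.card α).choose k) h1
    have h5 : 0 < S.card.factorial * (Fintype.card α - S.card).factorial := by positivity
    have h6 := Nat.mul_lt_mul_of_pos_right h2 h5
    omega
  obtain ⟨x, y, hxy⟩ : ∃ x y : α, y ∉ orbit U x := by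
    by_contra! h
    exact htr ⟨fun x y => h x y⟩
  have hSinv : ∀ g ∈ U, ∀ a, g a ∈ (orbit U x).toFinset ↔ a ∈ (orbit U x).toFinset := by
    intro g hg a
    rw [Set.mem_toFinset, Set.mem_toFinset]
    change (⟨g, hg⟩ : U) • a ∈ orbit U x ↔ a ∈ orbit U x
    rw [← orbit_eq_iff, orbit_smul, orbit_eq_iff]
  have hx : x ∈ (orbit U x).toFinset := by simp
  have hy : y ∈ ((orbit U x).toFinset)ᶜ := by simpa using hxy
  rcases hinv _ hSinv with h | h
  · exact ⟨_, Finset.card_pos.2 ⟨x, hx⟩, h, hSinv⟩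
  · refine ⟨_, Finset.card_pos.2 ⟨y, hy⟩, by rwa [Finset.card_compl], fun g hg a => ?_⟩
    rw [Finset.mem_compl, Finset.mem_compl, hSinv g hg a]

open Equiv MulAction in
/-- A permutation group of index at most `n.choose k`, where `4 * k + 2 ≤ n` and `n ≠ 6`,
contains all even permutations that fix a suitable set of at most `k` points. -/
theorem Equiv.Perm.exists_finset_forall_even_mem {α : Type*} [Fintype α] [DecidableEq α]
    (U : Subgroup (Perm α)) {k : ℕ} (hkn : 4 * k + 2 ≤ Fintype.card α)
    (hn : k = 0 ∨ 7 ≤ Fintype.card α)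
    (hU : (Fintype.card α).factorial ≤ (Fintype.card α).choose k * Nat.card U) :
    ∃ W : Finset α, W.card ≤ k ∧
      ∀ g : Perm α, Perm.sign g = 1 → (∀ a ∈ W, g a = a) → g ∈ U := by
  -- In the intransitive case a small invariant set `W` is split off, and induction applies to the
  -- elements of `U` fixing `W` pointwise, with `k` and `n` both lowered by `W.card`.
  induction k using Nat.strong_induction_on generalizing α with
  | _ k ih =>
    rcases Nat.eq_zero_or_pos k with rfl | hk
    · refine ⟨∅, by simp, fun g _ _ => ?_⟩
      have h1 : U = ⊤ := by
        apply Subgroup.eq_top_of_le_card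
        rw [Nat.card_perm, Nat.card_eq_fintype_card]
        simpa using hU
      rw [h1]
      exact Subgroup.mem_top g
    · have h7 : 7 ≤ Fintype.card α := hn.resolve_left (by omega)
      by_cases htr : IsPretransitive U α
      · refine ⟨∅, by simp, fun g hg _ => ?_⟩
        exact Perm.alternatingGroup_le_of_factorial_le U hk h7 hkn hU
          (Perm.mem_alternatingGroup.2 hg)
      · obtain ⟨W, hW1, hWk, hW⟩ := Perm.exists_invariant_finset U hU htr
        have hcard : Fintype.card {a // a ∉ W} = Fintype.card α - W.card := by
          rw [Fintype.card_subtype_compl, Fintype.card_coe]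
        have hH := Perm.card_le_mul_card_comap_ofSubtype U W hW
        set H := U.comap (Perm.ofSubtype : Perm {a // a ∉ W} →* Perm α) with hHdef
        have hHU : (Fintype.card {a // a ∉ W}).factorial ≤
            (Fintype.card {a // a ∉ W}).choose (k - W.card) * Nat.card H := by
          rw [hcard]
          set n := Fintype.card α
          set w := W.card
          have h1 := Nat.choose_mul_factorial_mul_factorial (show w ≤ n by omega)
          have h2 := Nat.choose_mul (n := n) hWk
          have h3 : n.choose k ≤ n.choose w * (n - w).choose (k - w) := by
            rw [← h2]
            exact Nat.le_mul_of_pos_right _ (Nat.choose_pos hWk)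
          have hp : 0 < n.choose w * w.factorial :=
            Nat.mul_pos (Nat.choose_pos (by omega)) w.factorial_pos
          refine Nat.le_of_mul_le_mul_left ?_ hp
          calc n.choose w * w.factorial * (n - w).factorial = n.factorial := h1
            _ ≤ n.choose k * Nat.card U := hU
            _ ≤ (n.choose w * (n - w).choose (k - w)) * (w.factorial * Nat.card H) :=
                Nat.mul_le_mul h3 hH
            _ = _ := by ring
        -- The six-point exception cannot reappear: if `k - W.card ≥ 1`, at least nine points
        -- remain.
        obtain ⟨W', hW'k, hW'⟩ := ih (k - W.card) (by omega) H (by omega) (by omega) hHU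
        refine ⟨W ∪ W'.map (Function.Embedding.subtype _), ?_, fun g hg hfix => ?_⟩
        · refine (Finset.card_union_le _ _).trans ?_
          rw [Finset.card_map]
          omega
        · have hgW : ∀ a ∈ W, g a = a := fun a ha => hfix a (by simp [ha])
          have hiff : ∀ a, g a ∉ W ↔ a ∉ W := by
            intro a
            refine not_congr ⟨fun h => ?_, fun h => by rwa [hgW a h]⟩
            have := g.injective (hgW _ h)
            rwa [this] at h
          obtain ⟨g', hg'⟩ : ∃ g' : Perm {a // a ∉ W}, Perm.ofSubtype g' = g :=
            ⟨g.subtypePerm hiff, Perm.ofSubtype_subtypePerm hiff fun a ha hmem => ha (hgW a hmem)⟩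
          have hmem : g' ∈ H := by
            refine hW' _ ?_ fun a ha => ?_
            · rw [← Perm.sign_ofSubtype, hg', hg]
            · apply Subtype.ext
              rw [← Perm.ofSubtype_apply_coe g' a, hg']
              exact hfix a (Finset.mem_union_right _ (Finset.mem_map_of_mem _ ha))
          rw [hHdef, Subgroup.mem_comap, hg'] at hmem
          exact hmem

/-! ### Affine combinations, and node permutations acting on edge sets -/

theorem AffineMap.map_sum_smul_of_sum_eq_one {ι V W : Type*} [AddCommGroup V] [Module ℝ V]
    [AddCommGroup W] [Module ℝ W] (p : V →ᵃ[ℝ] W) (s : Finset ι) (w : ι → ℝ) (y : ι → V)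
    (hw : ∑ i ∈ s, w i = 1) : p (∑ i ∈ s, w i • y i) = ∑ i ∈ s, w i • p (y i) := by
  have h : ∀ v, p v = p.linear v + p 0 := fun v => congrFun p.decomp v
  simp only [h (∑ i ∈ s, w i • y i), h (y _), smul_add, Finset.sum_add_distrib, map_sum, map_smul,
    ← Finset.sum_smul, hw, one_smul]

theorem AffineSubspace.sum_smul_mem_of_sum_eq_one {ι V : Type*} [AddCommGroup V] [Module ℝ V]
    (L : AffineSubspace ℝ V) (s : Finset ι) (w : ι → ℝ) (y : ι → V)
    (hw : ∑ i ∈ s, w i = 1) (hy : ∀ i ∈ s, y i ∈ L) : ∑ i ∈ s, w i • y i ∈ L := by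
  rw [← Finset.affineCombination_eq_linear_combination s y w hw]
  have h := affineCombination_mem_affineSpan_image hw (s' := (s : Set ι))
    (fun i hi hi' => absurd hi hi') y
  exact (affineSpan_le.2 (by rintro _ ⟨i, hi, rfl⟩; exact hy i hi) : _ ≤ L) h

theorem coordPerm_mul {B : Type*} (σ τ : Equiv.Perm B) (y : B → ℝ) :
    coordPerm (σ * τ) y = coordPerm σ (coordPerm τ y) := by
  funext j
  simp [mul_inv_rev]

theorem coordPerm_inv_coordPerm {B : Type*} (σ : Equiv.Perm B) (y : B → ℝ) :
    coordPerm σ⁻¹ (coordPerm σ y) = y := by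
  funext j
  simp

theorem edgePerm_mul {n : ℕ} (π τ : Equiv.Perm (Fin n)) :
    edgePerm (π * τ) = edgePerm π * edgePerm τ := by
  ext e : 2
  simp [Sym2.map_map]

theorem edgePerm_one {n : ℕ} : edgePerm (1 : Equiv.Perm (Fin n)) = 1 := by
  ext e : 2
  simp

theorem edgePerm_inv {n : ℕ} (π : Equiv.Perm (Fin n)) : edgePerm π⁻¹ = (edgePerm π)⁻¹ := by
  rw [eq_inv_iff_mul_eq_one, ← edgePerm_mul, inv_mul_cancel, edgePerm_one]

/-- The image of a set of edges under a permutation of the nodes. -/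
def mapEdges {n : ℕ} (π : Equiv.Perm (Fin n)) (M : Finset (KEdge n)) : Finset (KEdge n) :=
  M.map (edgePerm π).toEmbedding

theorem mem_mapEdges {n : ℕ} {π : Equiv.Perm (Fin n)} {M : Finset (KEdge n)} {e : KEdge n} :
    e ∈ mapEdges π M ↔ (edgePerm π)⁻¹ e ∈ M := by
  simp only [mapEdges, Finset.mem_map_equiv]
  rfl

theorem edgePerm_mem_mapEdges {n : ℕ} {π : Equiv.Perm (Fin n)} {M : Finset (KEdge n)}
    {e : KEdge n} : edgePerm π e ∈ mapEdges π M ↔ e ∈ M := by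
  simp [mem_mapEdges]

theorem mapEdges_mul {n : ℕ} (π τ : Equiv.Perm (Fin n)) (M : Finset (KEdge n)) :
    mapEdges (π * τ) M = mapEdges π (mapEdges τ M) := by
  ext e
  simp [mem_mapEdges, edgePerm_mul, mul_inv_rev]

theorem mapEdges_one {n : ℕ} (M : Finset (KEdge n)) : mapEdges 1 M = M := by
  ext e
  simp [mem_mapEdges, edgePerm_one]

theorem card_mapEdges {n : ℕ} (π : Equiv.Perm (Fin n)) (M : Finset (KEdge n)) :
    (mapEdges π M).card = M.card :=
  Finset.card_map _

theorem mem_edgePerm_iff {n : ℕ} {π : Equiv.Perm (Fin n)} {e : KEdge n} {v : Fin n} :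
    v ∈ (edgePerm π e : Sym2 (Fin n)) ↔ π⁻¹ v ∈ (e : Sym2 (Fin n)) := by
  rw [coe_edgePerm, Sym2.mem_map]
  constructor
  · rintro ⟨a, ha, rfl⟩
    simpa using ha
  · exact fun h => ⟨_, h, by simp⟩

theorem IsEdgeMatching.mapEdges {n : ℕ} {M : Finset (KEdge n)} (hM : IsEdgeMatching M)
    (π : Equiv.Perm (Fin n)) : IsEdgeMatching (mapEdges π M) := by
  intro e he f hf hef v hv
  rw [mem_mapEdges] at he hf
  refine hM _ he _ hf (fun h => hef (Equiv.injective _ h)) (π⁻¹ v) ?_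
  rw [← edgePerm_inv, mem_edgePerm_iff, mem_edgePerm_iff]
  simpa using hv

theorem mapEdges_mem_matchingsOfSize {n l : ℕ} {M : Finset (KEdge n)}
    (hM : M ∈ matchingsOfSize l n) (π : Equiv.Perm (Fin n)) :
    mapEdges π M ∈ matchingsOfSize l n :=
  ⟨hM.1.mapEdges π, (card_mapEdges π M).trans hM.2⟩

theorem charVec_mapEdges {n : ℕ} (π : Equiv.Perm (Fin n)) (M : Finset (KEdge n)) :
    charVec (mapEdges π M) = coordPerm (edgePerm π) (charVec M) := by
  classical
  funext e
  simp only [coordPerm_apply, charVec, Set.indicator_apply, Finset.mem_coe, mem_mapEdges,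
    Pi.one_apply]

theorem coordPerm_inv_mem_of_image_eq {B : Type*} {Q : Set (B → ℝ)} {σ : Equiv.Perm B}
    (h : coordPerm σ '' Q = Q) {y : B → ℝ} (hy : y ∈ Q) : coordPerm σ⁻¹ y ∈ Q := by
  rw [← h] at hy
  obtain ⟨z, hz, rfl⟩ := hy
  rwa [coordPerm_inv_coordPerm]

theorem coordPerm_mem_of_image_eq {B : Type*} {Q : Set (B → ℝ)} {σ : Equiv.Perm B}
    (h : coordPerm σ '' Q = Q) {y : B → ℝ} (hy : y ∈ Q) : coordPerm σ y ∈ Q :=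
  h ▸ Set.mem_image_of_mem _ hy

/-! ### Equivariant sections and the isotropy of their coordinates -/

/-- The pairs of a node permutation and a coordinate permutation that witness the symmetry of an
extension. -/
noncomputable def symmetryPairs {n d : ℕ} (Q : Set (Fin d → ℝ))
    (p : (Fin d → ℝ) →ᵃ[ℝ] (KEdge n → ℝ)) :
    Subgroup (Equiv.Perm (Fin n) × Equiv.Perm (Fin d)) where
  carrier := {h | coordPerm h.2 '' Q = Q ∧
    ∀ y ∈ Q, p (coordPerm h.2 y) = coordPerm (edgePerm h.1) (p y)}
  one_mem' := by
    have h1 : ∀ y : Fin d → ℝ, coordPerm 1 y = y := fun y => by funext j; simp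
    refine ⟨by simp [h1], fun y _ => ?_⟩
    funext e
    simp [h1, edgePerm_one]
  mul_mem' := by
    rintro ⟨π, σ⟩ ⟨π', σ'⟩ ⟨h1, h2⟩ ⟨h1', h2'⟩
    refine ⟨?_, fun y hy => ?_⟩
    · have : ∀ y, coordPerm (σ * σ') y = coordPerm σ (coordPerm σ' y) := coordPerm_mul σ σ'
      simp only [Prod.mk_mul_mk, this]
      rw [← Set.image_image, h1', h1]
    · simp only [Prod.mk_mul_mk, coordPerm_mul, edgePerm_mul]
      rw [h2 _ (coordPerm_mem_of_image_eq h1' hy), h2' y hy]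
  inv_mem' := by
    rintro ⟨π, σ⟩ ⟨h1, h2⟩
    refine ⟨?_, fun y hy => ?_⟩
    · simp only [Prod.inv_mk]
      conv_lhs => rw [← h1]
      rw [Set.image_image]
      simp [coordPerm_inv_coordPerm]
    · have h3 := h2 _ (coordPerm_inv_mem_of_image_eq h1 hy)
      have h4 : coordPerm σ (coordPerm σ⁻¹ y) = y := by
        conv_lhs => rw [← inv_inv σ]
        rw [inv_inv, ← inv_inv σ, inv_inv σ⁻¹, coordPerm_inv_coordPerm]
      simp only [Prod.inv_mk] at h3 ⊢
      rw [h4] at h3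
      rw [h3, edgePerm_inv, coordPerm_inv_coordPerm]

theorem convex_of_isSubspaceExtension {B : Type*} {d : ℕ} {P : Set (B → ℝ)}
    {Q : Set (Fin d → ℝ)} {p : (Fin d → ℝ) →ᵃ[ℝ] (B → ℝ)} (h : IsSubspaceExtension P Q p) :
    Convex ℝ Q := by
  obtain ⟨⟨L, rfl⟩, -⟩ := h
  refine Convex.inter (s := (L : Set (Fin d → ℝ))) L.convex ?_
  intro x hx y hy a b ha hb _ j
  exact add_nonneg (mul_nonneg ha (hx j)) (mul_nonneg hb (hy j))

/-- A coordinate-symmetric extension of the matching polytope admits a section over the vertices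
that is equivariant. -/
theorem exists_equivariant_section {n l d : ℕ} {Q : Set (Fin d → ℝ)}
    {p : (Fin d → ℝ) →ᵃ[ℝ] (KEdge n → ℝ)}
    (hext : IsSubspaceExtension (matchingPolytope l n) Q p)
    (hsym : IsCoordinateSymmetric (nodePermGroup n) Q p) :
    ∃ s : Finset (KEdge n) → Fin d → ℝ,
      (∀ M ∈ matchingsOfSize l n, s M ∈ Q ∧ p (s M) = charVec M) ∧
      ∀ π : Equiv.Perm (Fin n), ∃ κ : Equiv.Perm (Fin d),
        ∀ M, s (mapEdges π M) = coordPerm κ (s M) := by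
  classical
  have ht : ∀ M : Finset (KEdge n), ∃ y : Fin d → ℝ,
      M ∈ matchingsOfSize l n → y ∈ Q ∧ p y = charVec M := by
    intro M
    by_cases hM : M ∈ matchingsOfSize l n
    · have h1 : charVec M ∈ p '' Q := by
        rw [hext.2]
        exact subset_convexHull ℝ _ (Set.mem_image_of_mem _ hM)
      obtain ⟨y, hy, hpy⟩ := h1
      exact ⟨y, fun _ => ⟨hy, hpy⟩⟩
    · exact ⟨0, fun h => absurd h hM⟩
  choose t ht using ht
  -- A choice of coordinate permutation for each `π` need not be a homomorphism, so the average runs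
  -- over the group of all witnessing pairs instead of the node permutations.
  let H := symmetryPairs Q p
  have hHmem : ∀ h : H, coordPerm h.1.2 '' Q = Q ∧
    ∀ y ∈ Q, p (coordPerm h.1.2 y) = coordPerm (edgePerm h.1.1) (p y) := fun h => h.2
  have hcard : (Fintype.card H : ℝ) ≠ 0 := by exact_mod_cast Fintype.card_ne_zero
  have hw : ∑ _h : H, (Fintype.card H : ℝ)⁻¹ = 1 := by
    rw [Finset.sum_const, Finset.card_univ, nsmul_eq_mul, mul_inv_cancel₀ hcard]
  refine ⟨fun M => ∑ h : H, (Fintype.card H : ℝ)⁻¹ •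
    coordPerm (h.1.2)⁻¹ (t (mapEdges h.1.1 M)), fun M hM => ?_, fun π => ?_⟩
  · have hmem : ∀ h : H, coordPerm (h.1.2)⁻¹ (t (mapEdges h.1.1 M)) ∈ Q ∧
        p (coordPerm (h.1.2)⁻¹ (t (mapEdges h.1.1 M))) = charVec M := by
      intro h
      have h1 := ht _ (mapEdges_mem_matchingsOfSize hM h.1.1)
      refine ⟨coordPerm_inv_mem_of_image_eq (hHmem h).1 h1.1, ?_⟩
      have h2 := (hHmem h⁻¹).2 _ h1.1
      rw [h1.2, ← charVec_mapEdges, ← mapEdges_mul] at h2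
      have h3 : (h⁻¹).1.1 * h.1.1 = 1 := by simp
      rw [h3, mapEdges_one] at h2
      exact h2
    refine ⟨(convex_of_isSubspaceExtension hext).sum_mem
      (fun _ _ => by positivity) hw (fun h _ => (hmem h).1), ?_⟩
    rw [p.map_sum_smul_of_sum_eq_one _ _ _ hw]
    simp only [(hmem _).2]
    rw [← Finset.sum_smul, hw, one_smul]
  · obtain ⟨κ, hκ⟩ := hsym (coordPerm (edgePerm π)) ⟨π, rfl⟩
    refine ⟨κ, fun M => ?_⟩
    let g : H := ⟨(π, κ), hκ⟩
    funext j
    simp only [coordPerm_apply, Finset.sum_apply, Pi.smul_apply]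
    -- Replacing `h` by `h * g` turns `κ` applied to the average at `M` into the average at
    -- `mapEdges π M`.
    conv_rhs => rw [← Equiv.sum_comp (Equiv.mulRight g)]
    refine Finset.sum_congr rfl fun h _ => ?_
    simp [g, mapEdges_mul]

/-- The node permutations under which the function `f` of a set of edges is invariant. -/
def nodeIsotropy {n : ℕ} {X : Type*} (f : Finset (KEdge n) → X) :
    Subgroup (Equiv.Perm (Fin n)) where
  carrier := {g | ∀ M, f (mapEdges g M) = f M}
  one_mem' M := by rw [mapEdges_one]
  mul_mem' {g h} hg hh M := by rw [mapEdges_mul, hg, hh]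
  inv_mem' {g} hg M := by
    rw [← hg (mapEdges g⁻¹ M), ← mapEdges_mul, mul_inv_cancel, mapEdges_one]

/-- An orbit-stabilizer bound that does not need `κ` to be an action: two permutations with the same
value of `(κ π)⁻¹ j` differ by an element of the isotropy group. -/
theorem factorial_le_mul_card_nodeIsotropy {n d : ℕ} {s : Finset (KEdge n) → Fin d → ℝ}
    (hs : ∀ π : Equiv.Perm (Fin n), ∃ κ : Equiv.Perm (Fin d),
      ∀ M, s (mapEdges π M) = coordPerm κ (s M)) (j : Fin d) :
    n.factorial ≤ d * Nat.card (nodeIsotropy fun M => s M j) := by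
  classical
  choose κ hκ using hs
  have hj : ∀ π M, s (mapEdges π M) j = s M ((κ π)⁻¹ j) := fun π M => by
    rw [hκ, coordPerm_apply]
  have h1 := Finset.card_le_mul_card_image (f := fun π => (κ π)⁻¹ j)
    (Finset.univ : Finset (Equiv.Perm (Fin n))) (Nat.card (nodeIsotropy fun M => s M j)) ?_
  · rw [Finset.card_univ, Fintype.card_perm, Fintype.card_fin, mul_comm] at h1
    refine h1.trans (Nat.mul_le_mul_right _ ?_)
    simpa using Finset.card_le_univ (Finset.image (fun π => (κ π)⁻¹ j) Finset.univ)
  · intro a ha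
    obtain ⟨π₀, -, hπ₀⟩ := Finset.mem_image.1 ha
    rw [← Fintype.card_subtype, ← Nat.card_eq_fintype_card]
    refine Nat.card_le_card_of_injective (fun π => ⟨π.1 * π₀⁻¹, fun M => ?_⟩) ?_
    · have h2 : (κ π.1)⁻¹ j = a := π.2
      simp only [mapEdges_mul]
      rw [hj, h2, ← hπ₀, ← hj, ← mapEdges_mul, mul_inv_cancel, mapEdges_one]
    · intro π π' h
      exact Subtype.ext (mul_right_cancel (Subtype.mk.inj h))

theorem exists_finset_forall_even_invariant {n d k : ℕ} {s : Finset (KEdge n) → Fin d → ℝ}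
    (hs : ∀ π : Equiv.Perm (Fin n), ∃ κ : Equiv.Perm (Fin d),
      ∀ M, s (mapEdges π M) = coordPerm κ (s M))
    (hd : d ≤ n.choose k) (hkn : 4 * k + 2 ≤ n) (hn : k = 0 ∨ 7 ≤ n) (j : Fin d) :
    ∃ W : Finset (Fin n), W.card ≤ k ∧
      ∀ g : Equiv.Perm (Fin n), Equiv.Perm.sign g = 1 → (∀ a ∈ W, g a = a) →
        ∀ M, s (mapEdges g M) j = s M j := by
  refine Equiv.Perm.exists_finset_forall_even_mem (nodeIsotropy fun M => s M j) (k := k)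
    (by simpa using hkn) (by simpa using hn) ?_
  rw [Fintype.card_fin]
  exact (factorial_le_mul_card_nodeIsotropy hs j).trans (Nat.mul_le_mul_right _ hd)

/-! ### Matchings with the same edges at a node set -/

/-- The node `v` is an end of some edge in `M`. -/
def coveredBy {n : ℕ} (M : Finset (KEdge n)) (v : Fin n) : Prop :=
  ∃ e ∈ M, v ∈ (e : Sym2 (Fin n))

/-- The edges of `M` that meet the node set `W`. -/
def edgesMeeting {n : ℕ} (W : Finset (Fin n)) (M : Finset (KEdge n)) : Finset (KEdge n) :=
  M.filter fun e => ∃ v ∈ W, v ∈ (e : Sym2 (Fin n))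

theorem IsEdgeMatching.eq_of_mem {n : ℕ} {M : Finset (KEdge n)} (hM : IsEdgeMatching M)
    {e f : KEdge n} (he : e ∈ M) (hf : f ∈ M) {v : Fin n} (hve : v ∈ (e : Sym2 (Fin n)))
    (hvf : v ∈ (f : Sym2 (Fin n))) : e = f := by
  by_contra h
  exact hM e he f hf h v ⟨hve, hvf⟩

theorem KEdge.exists_eq {n : ℕ} (e : KEdge n) :
    ∃ a b : Fin n, a ≠ b ∧ (e : Sym2 (Fin n)) = s(a, b) := by
  obtain ⟨⟨a, b⟩, he⟩ := e
  exact ⟨a, b, by simpa using he, rfl⟩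

theorem edgePerm_eq_self {n : ℕ} {π : Equiv.Perm (Fin n)} {e : KEdge n}
    (h : ∀ v ∈ (e : Sym2 (Fin n)), π v = v) : edgePerm π e = e := by
  apply Subtype.ext
  obtain ⟨a, b, -, he⟩ := e.exists_eq
  rw [coe_edgePerm, he, Sym2.map_mk, h a (by simp [he]), h b (by simp [he])]

theorem KEdge.exists_eq_of_mem {n : ℕ} (e : KEdge n) {a : Fin n} (ha : a ∈ (e : Sym2 (Fin n))) :
    ∃ b : Fin n, a ≠ b ∧ (e : Sym2 (Fin n)) = s(a, b) := by
  obtain ⟨b, hb⟩ := ha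
  obtain ⟨c, d, hcd, h⟩ := e.exists_eq
  refine ⟨b, ?_, hb⟩
  rintro rfl
  rw [hb, Sym2.eq_iff] at h
  rcases h with ⟨rfl, rfl⟩ | ⟨rfl, rfl⟩ <;> exact hcd rfl

/-- Two matchings covering the same nodes and having the same edges at `W` differ by a
permutation of the nodes that fixes `W` pointwise. -/
theorem exists_perm_mapEdges_eq {n : ℕ} (W : Finset (Fin n)) {M M' : Finset (KEdge n)}
    (hM : IsEdgeMatching M) (hM' : IsEdgeMatching M')
    (hcov : ∀ v, coveredBy M v ↔ coveredBy M' v)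
    (hW : edgesMeeting W M = edgesMeeting W M') :
    ∃ g : Equiv.Perm (Fin n), (∀ a ∈ W, g a = a) ∧ mapEdges g M = M' := by
  classical
  -- If `e = uv` lies in `M` but not in `M'`, and `f = uw` is the edge of `M'` at `u`, then swapping
  -- `v` and `w` carries `e` to `f` and fixes all common edges, so the difference shrinks.
  induction hr : (M \ M').card using Nat.strong_induction_on generalizing M with
  | _ r ih =>
    by_cases hsub : M ⊆ M'
    · refine ⟨1, fun _ _ => rfl, ?_⟩
      rw [mapEdges_one]
      refine Finset.Subset.antisymm hsub fun f hf => ?_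
      obtain ⟨a, b, -, hab⟩ := f.exists_eq
      have haf : a ∈ (f : Sym2 (Fin n)) := by simp [hab]
      obtain ⟨e, he, hae⟩ := (hcov a).2 ⟨f, hf, haf⟩
      rwa [hM'.eq_of_mem hf (hsub he) haf hae]
    · obtain ⟨e, heM, heM'⟩ := Finset.not_subset.1 hsub
      obtain ⟨u, v, huv, he⟩ := e.exists_eq
      have hue : u ∈ (e : Sym2 (Fin n)) := by simp [he]
      have hve : v ∈ (e : Sym2 (Fin n)) := by simp [he]
      obtain ⟨f, hfM', huf⟩ := (hcov u).1 ⟨e, heM, hue⟩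
      obtain ⟨w, huw, hf⟩ := f.exists_eq_of_mem huf
      have hwf : w ∈ (f : Sym2 (Fin n)) := by simp [hf]
      have hfM : f ∉ M := by
        intro h
        exact heM' (hM.eq_of_mem heM h hue huf ▸ hfM')
      have hnoW : ∀ x ∈ W, x ≠ v ∧ x ≠ w := by
        intro x hx
        constructor
        · rintro rfl
          have : e ∈ edgesMeeting W M' := hW ▸ Finset.mem_filter.2 ⟨heM, x, hx, hve⟩
          exact heM' (Finset.mem_filter.1 this).1
        · rintro rfl
          have : f ∈ edgesMeeting W M := hW ▸ Finset.mem_filter.2 ⟨hfM', x, hx, hwf⟩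
          exact hfM (Finset.mem_filter.1 this).1
      have hfix : ∀ e' ∈ M, e' ∈ M' → edgePerm (Equiv.swap v w) e' = e' := by
        intro e' h1 h2
        refine edgePerm_eq_self fun x hx => Equiv.swap_apply_of_ne_of_ne ?_ ?_
        · rintro rfl
          exact heM' (hM.eq_of_mem heM h1 hve hx ▸ h2)
        · rintro rfl
          exact hfM (hM'.eq_of_mem hfM' h2 hwf hx ▸ h1)
      have hef : edgePerm (Equiv.swap v w) e = f := by
        apply Subtype.ext
        rw [coe_edgePerm, he, hf, Sym2.map_mk, Equiv.swap_apply_left,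
          Equiv.swap_apply_of_ne_of_ne huv huw]
      set M₁ := mapEdges (Equiv.swap v w) M with hM₁
      have hlt : (M₁ \ M').card < (M \ M').card := by
        have h1 : M₁ \ M' ⊆ ((M \ M').erase e).map (edgePerm (Equiv.swap v w)).toEmbedding := by
          intro e' he'
          rw [Finset.mem_sdiff, hM₁, mapEdges, Finset.mem_map] at he'
          obtain ⟨⟨e₀, h2, rfl⟩, h3⟩ := he'
          refine Finset.mem_map_of_mem _ (Finset.mem_erase.2 ⟨?_, Finset.mem_sdiff.2 ⟨h2, ?_⟩⟩)
          · rintro rfl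
            exact h3 (by simpa [hef] using hfM')
          · intro h4
            exact h3 (by simpa [hfix e₀ h2 h4] using h4)
        refine (Finset.card_le_card h1).trans_lt ?_
        rw [Finset.card_map]
        exact Finset.card_erase_lt_of_mem (Finset.mem_sdiff.2 ⟨heM, heM'⟩)
      have hvw : coveredBy M v ∧ coveredBy M w :=
        ⟨⟨e, heM, hve⟩, (hcov w).2 ⟨f, hfM', hwf⟩⟩
      have hcov₁ : ∀ x, coveredBy M₁ x ↔ coveredBy M x := by
        intro x
        have h1 : coveredBy M₁ x ↔ coveredBy M (Equiv.swap v w x) := by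
          constructor
          · rintro ⟨e', he', hx⟩
            rw [hM₁, mem_mapEdges, ← edgePerm_inv] at he'
            refine ⟨_, he', ?_⟩
            rw [mem_edgePerm_iff]
            simpa using hx
          · rintro ⟨e', he', hx⟩
            refine ⟨_, edgePerm_mem_mapEdges.2 he', ?_⟩
            rw [mem_edgePerm_iff]
            simpa using hx
        rw [h1]
        by_cases hxv : x = v
        · rw [hxv, Equiv.swap_apply_left]
          exact iff_of_true hvw.2 hvw.1
        · by_cases hxw : x = w
          · rw [hxw, Equiv.swap_apply_right]
            exact iff_of_true hvw.1 hvw.2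
          · rw [Equiv.swap_apply_of_ne_of_ne hxv hxw]
      have hswW : ∀ x ∈ W, Equiv.swap v w x = x := fun x hx =>
        Equiv.swap_apply_of_ne_of_ne (hnoW x hx).1 (hnoW x hx).2
      have hW₁ : edgesMeeting W M₁ = edgesMeeting W M' := by
        rw [← hW]
        ext e'
        simp only [edgesMeeting, Finset.mem_filter]
        refine and_congr_left ?_
        rintro ⟨x, hx, hxe⟩
        constructor
        · intro h
          rw [hM₁, mem_mapEdges] at h
          have h2 : x ∈ ((edgePerm (Equiv.swap v w))⁻¹ e' : Sym2 (Fin n)) := by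
            rw [← edgePerm_inv, mem_edgePerm_iff]
            simpa [hswW x hx] using hxe
          have h3 : (edgePerm (Equiv.swap v w))⁻¹ e' ∈ edgesMeeting W M' :=
            hW ▸ Finset.mem_filter.2 ⟨h, x, hx, h2⟩
          have h4 := hfix _ h (Finset.mem_filter.1 h3).1
          have h5 : edgePerm (Equiv.swap v w) ((edgePerm (Equiv.swap v w))⁻¹ e') = e' := by simp
          rw [h5] at h4
          rwa [← h4] at h
        · intro h
          have h3 : e' ∈ edgesMeeting W M' := hW ▸ Finset.mem_filter.2 ⟨h, x, hx, hxe⟩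
          have h4 := hfix _ h (Finset.mem_filter.1 h3).1
          rw [← h4]
          exact edgePerm_mem_mapEdges.2 h
      obtain ⟨g, hg, hgM⟩ := ih _ (hr ▸ hlt) (hM.mapEdges _)
        (fun x => (hcov₁ x).trans (hcov x)) hW₁ rfl
      refine ⟨g * Equiv.swap v w, fun x hx => ?_, ?_⟩
      · rw [Equiv.Perm.mul_apply, hswW x hx, hg x hx]
      · rw [mapEdges_mul, hgM]

theorem card_edgesMeeting_le {n : ℕ} (W : Finset (Fin n)) {M : Finset (KEdge n)}
    (hM : IsEdgeMatching M) : (edgesMeeting W M).card ≤ W.card := by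
  classical
  have h : ∀ e ∈ edgesMeeting W M, ∃ v ∈ W, v ∈ (e : Sym2 (Fin n)) := fun e he =>
    (Finset.mem_filter.1 he).2
  rcases (edgesMeeting W M).eq_empty_or_nonempty with h0 | ⟨e₀, he₀⟩
  · simp [h0]
  have : Nonempty (Fin n) := ⟨(h e₀ he₀).choose⟩
  choose! f hf using h
  refine Finset.card_le_card_of_injOn f (fun e he => (hf e he).1) ?_
  intro e he e' he' hee'
  refine hM.eq_of_mem (Finset.mem_filter.1 he).1 (Finset.mem_filter.1 he').1 (hf e he).2 ?_
  rw [hee']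
  exact (hf e' he').2

/-- Since `M'` has more edges than `W` has nodes, some edge of `M'` avoids `W`. Swapping its two
ends preserves `M'`, fixes `W`, and corrects the sign. -/
theorem exists_even_perm_mapEdges_eq {n : ℕ} (W : Finset (Fin n)) {M M' : Finset (KEdge n)}
    (hM : IsEdgeMatching M) (hM' : IsEdgeMatching M') (hlt : W.card < M'.card)
    (hcov : ∀ v, coveredBy M v ↔ coveredBy M' v)
    (hW : edgesMeeting W M = edgesMeeting W M') :
    ∃ g : Equiv.Perm (Fin n), Equiv.Perm.sign g = 1 ∧ (∀ a ∈ W, g a = a) ∧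
      mapEdges g M = M' := by
  obtain ⟨g, hg, hgM⟩ := exists_perm_mapEdges_eq W hM hM' hcov hW
  rcases Int.units_eq_one_or (Equiv.Perm.sign g) with h1 | h1
  · exact ⟨g, h1, hg, hgM⟩
  obtain ⟨e, heM', heW⟩ : ∃ e ∈ M', e ∉ edgesMeeting W M' := by
    by_contra! h
    have := Finset.card_le_card (show M' ⊆ edgesMeeting W M' from h)
    have := card_edgesMeeting_le W hM'
    omega
  have hdis : ∀ v ∈ W, v ∉ (e : Sym2 (Fin n)) := fun v hv hve =>
    heW (Finset.mem_filter.2 ⟨heM', v, hv, hve⟩)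
  obtain ⟨a, b, hab, he⟩ := e.exists_eq
  have hae : a ∈ (e : Sym2 (Fin n)) := by simp [he]
  have hbe : b ∈ (e : Sym2 (Fin n)) := by simp [he]
  have hself : mapEdges (Equiv.swap a b) M' = M' := by
    have h2 : ∀ f ∈ M', edgePerm (Equiv.swap a b) f = f := by
      intro f hf
      by_cases hfe : f = e
      · subst hfe
        apply Subtype.ext
        rw [coe_edgePerm, he, Sym2.map_mk, Equiv.swap_apply_left, Equiv.swap_apply_right,
          Sym2.eq_swap]
      · refine edgePerm_eq_self fun x hx => Equiv.swap_apply_of_ne_of_ne ?_ ?_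
        · rintro rfl
          exact hfe (hM'.eq_of_mem hf heM' hx hae)
        · rintro rfl
          exact hfe (hM'.eq_of_mem hf heM' hx hbe)
    refine (Finset.eq_of_subset_of_card_le (fun f hf => ?_) (card_mapEdges _ _).le).symm
    rw [← h2 f hf]
    exact edgePerm_mem_mapEdges.2 hf
  refine ⟨Equiv.swap a b * g, ?_, fun x hx => ?_, by rw [mapEdges_mul, hgM, hself]⟩
  · rw [Equiv.Perm.sign_mul, h1, Equiv.Perm.sign_swap hab]
    rfl
  · rw [Equiv.Perm.mul_apply, hg x hx]
    refine Equiv.swap_apply_of_ne_of_ne ?_ ?_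
    · rintro rfl
      exact hdis _ hx hae
    · rintro rfl
      exact hdis _ hx hbe

/-! ### Counting matchings by edge types -/

/-- The type of an edge with respect to a classification `side` of the nodes. -/
def edgeType {n : ℕ} {ι : Type*} (side : Fin n → ι) (e : KEdge n) : Sym2 ι :=
  Sym2.map side (e : Sym2 (Fin n))

open Classical in
/-- The edges of `M` of type `τ`. -/
noncomputable def edgesOfType {n : ℕ} {ι : Type*} (side : Fin n → ι) (τ : Sym2 ι)
    (M : Finset (KEdge n)) : Finset (KEdge n) :=
  M.filter fun e => edgeType side e = τ

open Classical in
/-- The matchings that cover exactly the nodes whose side satisfies `cov` and that have `m τ` edges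
of type `τ`, for every `τ`. -/
noncomputable def typedMatchings {n : ℕ} {ι : Type*} (side : Fin n → ι) (cov : ι → Prop)
    (m : Sym2 ι → ℕ) : Finset (Finset (KEdge n)) :=
  Finset.univ.filter fun M => IsEdgeMatching M ∧ (∀ v, coveredBy M v ↔ cov (side v)) ∧
    ∀ τ, (edgesOfType side τ M).card = m τ

open Classical in
/-- The members of the family `𝓜` that contain the edge set `F`. -/
noncomputable def membersContaining {n : ℕ} (𝓜 : Finset (Finset (KEdge n)))
    (F : Finset (KEdge n)) : Finset (Finset (KEdge n)) :=
  𝓜.filter fun M => F ⊆ M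

theorem mem_edgesOfType {n : ℕ} {ι : Type*} {side : Fin n → ι} {τ : Sym2 ι}
    {M : Finset (KEdge n)} {e : KEdge n} :
    e ∈ edgesOfType side τ M ↔ e ∈ M ∧ edgeType side e = τ := by
  simp [edgesOfType]

theorem mem_typedMatchings {n : ℕ} {ι : Type*} {side : Fin n → ι} {cov : ι → Prop}
    {m : Sym2 ι → ℕ} {M : Finset (KEdge n)} :
    M ∈ typedMatchings side cov m ↔ IsEdgeMatching M ∧ (∀ v, coveredBy M v ↔ cov (side v)) ∧
      ∀ τ, (edgesOfType side τ M).card = m τ := by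
  simp [typedMatchings]

theorem mem_membersContaining {n : ℕ} {𝓜 : Finset (Finset (KEdge n))}
    {F M : Finset (KEdge n)} : M ∈ membersContaining 𝓜 F ↔ M ∈ 𝓜 ∧ F ⊆ M := by
  simp [membersContaining]

theorem membersContaining_empty {n : ℕ} (𝓜 : Finset (Finset (KEdge n))) :
    membersContaining 𝓜 ∅ = 𝓜 := by
  ext M
  simp [mem_membersContaining]

theorem edgeType_edgePerm {n : ℕ} {ι : Type*} {side : Fin n → ι} {g : Equiv.Perm (Fin n)}
    (hg : ∀ v, side (g v) = side v) (e : KEdge n) :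
    edgeType side (edgePerm g e) = edgeType side e := by
  obtain ⟨a, b, -, he⟩ := e.exists_eq
  rw [edgeType, edgeType, coe_edgePerm, he]
  simp [hg]

theorem mapEdges_mem_typedMatchings {n : ℕ} {ι : Type*} {side : Fin n → ι} {cov : ι → Prop}
    {m : Sym2 ι → ℕ} {M : Finset (KEdge n)} (hM : M ∈ typedMatchings side cov m)
    {g : Equiv.Perm (Fin n)} (hg : ∀ v, side (g v) = side v) :
    mapEdges g M ∈ typedMatchings side cov m := by
  rw [mem_typedMatchings] at hM ⊢
  obtain ⟨h1, h2, h3⟩ := hM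
  have hg' : ∀ v, side (g⁻¹ v) = side v := fun v => by
    rw [← hg (g⁻¹ v)]
    simp
  refine ⟨h1.mapEdges g, fun v => ?_, fun τ => ?_⟩
  · rw [← hg' v, ← h2]
    constructor
    · rintro ⟨e, he, hv⟩
      rw [mem_mapEdges, ← edgePerm_inv] at he
      refine ⟨_, he, ?_⟩
      rw [mem_edgePerm_iff]
      simpa using hv
    · rintro ⟨e, he, hv⟩
      exact ⟨_, edgePerm_mem_mapEdges.2 he, mem_edgePerm_iff.2 hv⟩
  · rw [← h3, ← card_mapEdges g (edgesOfType side τ M)]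
    congr 1
    ext e
    rw [mem_edgesOfType, mem_mapEdges, mem_mapEdges, mem_edgesOfType, ← edgePerm_inv,
      edgeType_edgePerm hg']

/-- The edge `e` shares no node with the edges in `F`. -/
def AvoidsEdges {n : ℕ} (F : Finset (KEdge n)) (e : KEdge n) : Prop :=
  ∀ f ∈ F, ∀ v, v ∈ (e : Sym2 (Fin n)) → v ∉ (f : Sym2 (Fin n))

theorem exists_side_preserving_perm {n : ℕ} {ι : Type*} {side : Fin n → ι}
    {F : Finset (KEdge n)} {e e' : KEdge n} (he : AvoidsEdges F e) (he' : AvoidsEdges F e')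
    (htype : edgeType side e = edgeType side e') :
    ∃ g : Equiv.Perm (Fin n), (∀ v, side (g v) = side v) ∧ (∀ f ∈ F, edgePerm g f = f) ∧
      edgePerm g e = e' := by
  obtain ⟨a, b, hab, hea⟩ := e.exists_eq
  obtain ⟨a', b', hab', hea', hsa, hsb⟩ : ∃ a' b' : Fin n, a' ≠ b' ∧
      (e' : Sym2 (Fin n)) = s(a', b') ∧ side a = side a' ∧ side b = side b' := by
    obtain ⟨a', b', hab', hea'⟩ := e'.exists_eq
    rw [edgeType, edgeType, hea, hea', Sym2.map_mk, Sym2.map_mk, Sym2.eq_iff] at htype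
    rcases htype with ⟨h1, h2⟩ | ⟨h1, h2⟩
    · exact ⟨a', b', hab', hea', h1, h2⟩
    · exact ⟨b', a', hab'.symm, hea'.trans Sym2.eq_swap, h1, h2⟩
  have hswap : ∀ x y : Fin n, side x = side y → ∀ v, side (Equiv.swap x y v) = side v := by
    intro x y hxy v
    rw [Equiv.swap_apply_def]
    split_ifs with h1 h2
    · rw [h1, hxy]
    · rw [h2, hxy]
    · rfl
  -- The first swap sends `a` to `a'` and may move `b`, namely when `b = a'`; the second swap then
  -- sends the image `b''` to `b'`.
  set b'' := Equiv.swap a a' b with hb''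
  have hsb'' : side b'' = side b' := by rw [hb'', hswap a a' hsa, hsb]
  have hne : a' ≠ b'' := by
    intro h
    exact hab ((Equiv.swap a a').injective ((Equiv.swap_apply_left a a').trans h))
  refine ⟨Equiv.swap b'' b' * Equiv.swap a a', fun v => ?_, fun f hf => ?_, ?_⟩
  · rw [Equiv.Perm.mul_apply, hswap _ _ hsb'', hswap _ _ hsa]
  · refine edgePerm_eq_self fun v hv => ?_
    have h1 : v ≠ a := by rintro rfl; exact he f hf v (by simp [hea]) hv
    have h2 : v ≠ b := by rintro rfl; exact he f hf v (by simp [hea]) hv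
    have h3 : v ≠ a' := by rintro rfl; exact he' f hf v (by simp [hea']) hv
    have h4 : v ≠ b' := by rintro rfl; exact he' f hf v (by simp [hea']) hv
    have h5 : v ≠ b'' := by
      rw [hb'', Equiv.swap_apply_def]
      split_ifs <;> assumption
    rw [Equiv.Perm.mul_apply, Equiv.swap_apply_of_ne_of_ne h1 h3,
      Equiv.swap_apply_of_ne_of_ne h5 h4]
  · apply Subtype.ext
    rw [coe_edgePerm, hea, hea', Sym2.map_mk, Equiv.Perm.mul_apply, Equiv.Perm.mul_apply, ← hb'',
      Equiv.swap_apply_left a a', Equiv.swap_apply_left,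
      Equiv.swap_apply_of_ne_of_ne hne hab']

open Classical in
theorem card_membersContaining_insert_le {n : ℕ} {ι : Type*} {side : Fin n → ι}
    {cov : ι → Prop} {m : Sym2 ι → ℕ} {F : Finset (KEdge n)} {e e' : KEdge n}
    (he : AvoidsEdges F e) (he' : AvoidsEdges F e')
    (htype : edgeType side e = edgeType side e') :
    (membersContaining (typedMatchings side cov m) (insert e F)).card ≤
      (membersContaining (typedMatchings side cov m) (insert e' F)).card := by
  obtain ⟨g, hg, hgF, hge⟩ := exists_side_preserving_perm he he' htype
  refine Finset.card_le_card_of_injOn (mapEdges g) (fun M hM => ?_)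
    (fun M _ M' _ h => Finset.map_injective _ h)
  rw [Finset.mem_coe, mem_membersContaining] at hM ⊢
  refine ⟨mapEdges_mem_typedMatchings hM.1 hg, fun f hf => ?_⟩
  rcases Finset.mem_insert.1 hf with rfl | hf
  · rw [← hge]
    exact edgePerm_mem_mapEdges.2 (hM.2 (Finset.mem_insert_self _ _))
  · rw [← hgF f hf]
    exact edgePerm_mem_mapEdges.2 (hM.2 (Finset.mem_insert_of_mem hf))

open Classical in
/-- Among the typed matchings that contain `F`, all edges of the same type as `e` that avoid `F`
are equally frequent. -/
theorem card_membersContaining_insert_mul {n : ℕ} {ι : Type*} {side : Fin n → ι}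
    {cov : ι → Prop} {m : Sym2 ι → ℕ} {F : Finset (KEdge n)} {e : KEdge n}
    (he : AvoidsEdges F e) :
    ((membersContaining (typedMatchings side cov m) (insert e F)).card : ℝ) *
      ((Finset.univ.filter fun e' : KEdge n =>
        edgeType side e' = edgeType side e ∧ AvoidsEdges F e').card : ℝ) =
    (membersContaining (typedMatchings side cov m) F).card *
      ((m (edgeType side e) : ℝ) - (edgesOfType side (edgeType side e) F).card) := by
  set 𝓜 := typedMatchings side cov m with h𝓜
  set τ := edgeType side e with hτ
  set E := Finset.univ.filter fun e' : KEdge n => edgeType side e' = τ ∧ AvoidsEdges F e' with hE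
  -- Double counting of pairs `e' ∈ M`: every admissible `e'` lies in equally many `M`, and every
  -- `M` contains `m τ` edges of type `τ`, of which exactly those outside `F` avoid `F`.
  have h1 := Finset.sum_card_bipartiteAbove_eq_sum_card_bipartiteBelow
    (s := E) (t := membersContaining 𝓜 F) (fun (e' : KEdge n) M => e' ∈ M)
  have h2 : ∀ e' ∈ E, (Finset.bipartiteAbove (fun (e' : KEdge n) M => e' ∈ M)
      (membersContaining 𝓜 F) e').card = (membersContaining 𝓜 (insert e F)).card := by
    intro e' he'
    obtain ⟨h3, h4⟩ := (Finset.mem_filter.1 he').2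
    have h5 : Finset.bipartiteAbove (fun (e' : KEdge n) M => e' ∈ M)
        (membersContaining 𝓜 F) e' = membersContaining 𝓜 (insert e' F) := by
      ext M
      rw [Finset.mem_bipartiteAbove, mem_membersContaining, mem_membersContaining,
        Finset.insert_subset_iff]
      tauto
    rw [h5]
    exact le_antisymm (card_membersContaining_insert_le h4 he h3)
      (card_membersContaining_insert_le he h4 h3.symm)
  have h3 : ∀ M ∈ membersContaining 𝓜 F,
      ((Finset.bipartiteBelow (fun (e' : KEdge n) M => e' ∈ M) E M).card : ℝ) =
        (m τ : ℝ) - (edgesOfType side τ F).card := by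
    intro M hM
    obtain ⟨hM1, hFM⟩ := mem_membersContaining.1 hM
    obtain ⟨hmat, -, hcount⟩ := mem_typedMatchings.1 hM1
    have h4 : Finset.bipartiteBelow (fun (e' : KEdge n) M => e' ∈ M) E M =
        edgesOfType side τ M \ edgesOfType side τ F := by
      ext f
      rw [Finset.mem_bipartiteBelow, Finset.mem_sdiff, mem_edgesOfType, mem_edgesOfType, hE,
        Finset.mem_filter]
      constructor
      · rintro ⟨⟨-, h5, h6⟩, h7⟩
        refine ⟨⟨h7, h5⟩, fun h8 => ?_⟩
        obtain ⟨a, b, -, hf⟩ := f.exists_eq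
        exact h6 f h8.1 a (by simp [hf]) (by simp [hf])
      · rintro ⟨⟨h5, h6⟩, h7⟩
        refine ⟨⟨Finset.mem_univ _, h6, fun f' hf' v hv hv' => ?_⟩, h5⟩
        exact h7 ⟨hmat.eq_of_mem h5 (hFM hf') hv hv' ▸ hf', h6⟩
    have h5 : edgesOfType side τ F ⊆ edgesOfType side τ M := by
      intro f hf
      rw [mem_edgesOfType] at hf ⊢
      exact ⟨hFM hf.1, hf.2⟩
    rw [h4, Finset.cast_card_sdiff h5, hcount]
  rw [Finset.sum_congr rfl h2, Finset.sum_const, smul_eq_mul] at h1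
  have h4 : ((E.card * (membersContaining 𝓜 (insert e F)).card : ℕ) : ℝ) =
      ∑ M ∈ membersContaining 𝓜 F,
        ((Finset.bipartiteBelow (fun (e' : KEdge n) M => e' ∈ M) E M).card : ℝ) := by
    rw [h1]
    push_cast
    rfl
  rw [Finset.sum_congr rfl h3, Finset.sum_const, nsmul_eq_mul] at h4
  push_cast at h4
  rw [mul_comm, h4]

open Polynomial in
/-- If the numbers of edges of the various types are polynomials of degree at most one in a
parameter `t`, then the proportion of typed matchings that contain `F` is a polynomial in `t` of
degree at most the cardinality of `F`. -/
theorem exists_polynomial_card_membersContaining {n : ℕ} {ι : Type*} {side : Fin n → ι}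
    {cov : ι → Prop} {T : Set ℕ} {m : ℕ → Sym2 ι → ℕ} {P : Sym2 ι → ℝ[X]} {x : ℝ}
    (hdeg : ∀ τ, (P τ).natDegree ≤ 1) (hP : ∀ t ∈ T, ∀ τ, (P τ).eval (t : ℝ) = m t τ)
    (hx : ∀ t ∈ T, ∀ τ, (P τ).eval x = 0 ∨ (m t τ : ℝ) ≤ (P τ).eval x)
    (F : Finset (KEdge n)) (hF : ∃ t ∈ T, ∃ M ∈ typedMatchings side cov (m t), F ⊆ M) :
    ∃ q : ℝ[X], q.natDegree ≤ F.card ∧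
      (∀ t ∈ T, ((membersContaining (typedMatchings side cov (m t)) F).card : ℝ) =
        (typedMatchings side cov (m t)).card * q.eval (t : ℝ)) ∧
      0 ≤ q.eval x ∧ ((∃ f ∈ F, (P (edgeType side f)).eval x = 0) → q.eval x = 0) := by
  classical
  induction F using Finset.induction_on with
  | empty => exact ⟨1, by simp, by simp [membersContaining_empty], by simp, by simp⟩
  | insert e F heF ih =>
    obtain ⟨t₀, ht₀, M, hM, hFM⟩ := hF
    obtain ⟨hmat, -, hcount⟩ := mem_typedMatchings.1 hM
    obtain ⟨q, hq1, hq2, hq3, hq4⟩ :=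
      ih ⟨t₀, ht₀, M, hM, (Finset.subset_insert e F).trans hFM⟩
    have hav : AvoidsEdges F e := by
      intro f hf v hve hvf
      have := hmat.eq_of_mem (hFM (Finset.mem_insert_self _ _))
        (hFM (Finset.mem_insert_of_mem hf)) hve hvf
      exact heF (this ▸ hf)
    set τ := edgeType side e with hτ
    set D : ℝ := ((Finset.univ.filter fun e' : KEdge n =>
        edgeType side e' = edgeType side e ∧ AvoidsEdges F e').card : ℝ) with hD
    have hDpos : 0 < D := by
      rw [hD, Nat.cast_pos, Finset.card_pos]
      exact ⟨e, by simp [hav]⟩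
    have hle : ((edgesOfType side τ F).card : ℝ) ≤ m t₀ τ := by
      rw [← hcount τ, Nat.cast_le]
      refine Finset.card_le_card fun f hf => ?_
      rw [mem_edgesOfType] at hf ⊢
      exact ⟨hFM (Finset.mem_insert_of_mem hf.1), hf.2⟩
    -- When `P τ` vanishes at `x`, the new factor is negative as soon as `F` has an edge of type
    -- `τ`, but then `q` already vanishes at `x`. This is why the vanishing clause is carried
    -- through the induction.
    have hzero : (P τ).eval x = 0 →
        q.eval x * (D⁻¹ * ((P τ).eval x - (edgesOfType side τ F).card)) = 0 := by
      intro h0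
      by_cases hne : (edgesOfType side τ F).card = 0
      · simp [h0, hne]
      · obtain ⟨f, hf⟩ := Finset.card_pos.1 (Nat.pos_of_ne_zero hne)
        rw [mem_edgesOfType] at hf
        rw [hq4 ⟨f, hf.1, by rw [hf.2, h0]⟩, zero_mul]
    refine ⟨q * (C D⁻¹ * (P τ - C ((edgesOfType side τ F).card : ℝ))), ?_, fun t ht => ?_,
      ?_, ?_⟩
    · rw [Finset.card_insert_of_notMem heF]
      refine natDegree_mul_le.trans (Nat.add_le_add hq1 ?_)
      refine (natDegree_C_mul_le _ _).trans ?_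
      rw [natDegree_sub_C]
      exact hdeg τ
    · have h1 := card_membersContaining_insert_mul (side := side) (cov := cov) (m := m t) hav
      rw [hq2 t ht, ← hτ, ← hP t ht] at h1
      rw [eval_mul, eval_mul, eval_sub, eval_C, eval_C]
      have h2 := eq_div_of_mul_eq hDpos.ne' h1
      rw [h2]
      field_simp
    · rw [eval_mul, eval_mul, eval_sub, eval_C, eval_C]
      rcases hx t₀ ht₀ τ with h0 | h0
      · exact (hzero h0).ge
      · exact mul_nonneg hq3 (mul_nonneg (inv_pos.2 hDpos).le (by linarith))
    · rintro ⟨f, hf, hf0⟩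
      rw [eval_mul, eval_mul, eval_sub, eval_C, eval_C]
      rcases Finset.mem_insert.1 hf with rfl | hf
      · exact hzero hf0
      · rw [hq4 ⟨f, hf, hf0⟩, zero_mul]

/-! ### Matchings with a prescribed number of crossing edges -/

/-- The side of a node: the first `l` nodes, the next `l` nodes, and the remaining ones. -/
def nodeSide (n l : ℕ) (v : Fin n) : Fin 3 :=
  if (v : ℕ) < l then 0 else if (v : ℕ) < 2 * l then 1 else 2

/-- The prescribed number of edges of each type in a matching with `2 * t + 1` crossing edges. -/
def typeCount (k t : ℕ) (τ : Sym2 (Fin 3)) : ℕ :=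
  if τ = s(0, 1) then 2 * t + 1 else if τ = s(0, 0) ∨ τ = s(1, 1) then k - t else 0

/-- The matchings that perfectly match the first `2 * (2 * k + 1)` nodes and have exactly
`2 * t + 1` edges between the first and the second half of these nodes. -/
noncomputable def crossingMatchings (n k t : ℕ) : Finset (Finset (KEdge n)) :=
  typedMatchings (nodeSide n (2 * k + 1)) (· ≠ 2) (typeCount k t)

theorem typeCount_sum {k t : ℕ} (ht : t ≤ k) : ∑ τ, typeCount k t τ = 2 * k + 1 := by
  have h : ∀ τ : Sym2 (Fin 3), typeCount k t τ =
      (if τ = s(0, 1) then 2 * t + 1 else 0) + (if τ = s(0, 0) then k - t else 0) +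
        (if τ = s(1, 1) then k - t else 0) := by
    intro τ
    unfold typeCount
    by_cases h1 : τ = s(0, 1)
    · subst h1
      simp
    · by_cases h2 : τ = s(0, 0)
      · subst h2
        simp
      · by_cases h3 : τ = s(1, 1) <;> simp [h1, h2, h3]
  simp only [h, Finset.sum_add_distrib, Finset.sum_ite_eq', Finset.mem_univ, if_true]
  omega

theorem mem_matchingsOfSize_of_mem_crossingMatchings {n k t : ℕ} (ht : t ≤ k)
    {M : Finset (KEdge n)} (hM : M ∈ crossingMatchings n k t) :
    M ∈ matchingsOfSize (2 * k + 1) n := by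
  classical
  obtain ⟨h1, -, h3⟩ := mem_typedMatchings.1 hM
  refine ⟨h1, ?_⟩
  rw [← typeCount_sum ht, Finset.card_eq_sum_card_fiberwise (f := edgeType (nodeSide n (2 * k + 1)))
    (t := Finset.univ) (fun _ _ => Finset.mem_coe.2 (Finset.mem_univ _))]
  refine Finset.sum_congr rfl fun τ _ => ?_
  rw [← h3 τ]
  congr 1
  ext e
  simp [mem_edgesOfType]

theorem crossingMatchings_nonempty {n k t : ℕ} (hn : 2 * (2 * k + 1) ≤ n) (ht : t ≤ k) :
    (crossingMatchings n k t).Nonempty := by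
  classical
  -- Edge `r` joins `p r` to `q r`. For `r < 2 * t + 1` it goes straight across; beyond that, odd
  -- `r` labels the pair of positions `r, r + 1` in the first half, and even `r` the pair `r - 1, r`
  -- in the second half. The label of the edge at node `v` is `idx v`.
  let p : ℕ → ℕ := fun r => if r < 2 * t + 1 then r else if r % 2 = 1 then r else 2 * k + r
  let q : ℕ → ℕ := fun r =>
    if r < 2 * t + 1 then 2 * k + 1 + r else if r % 2 = 1 then r + 1 else 2 * k + 1 + r
  let idx : ℕ → ℕ := fun v =>
    if v < 2 * k + 1 then (if v < 2 * t + 1 then v else if v % 2 = 1 then v else v - 1)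
    else if v - (2 * k + 1) < 2 * t + 1 then v - (2 * k + 1)
    else if (v - (2 * k + 1)) % 2 = 1 then v - (2 * k + 1) + 1 else v - (2 * k + 1)
  have hplt : ∀ r, r < 2 * k + 1 → p r < 2 * (2 * k + 1) := by
    intro r hr; simp only [p]; split_ifs <;> omega
  have hqlt : ∀ r, r < 2 * k + 1 → q r < 2 * (2 * k + 1) := by
    intro r hr; simp only [q]; split_ifs <;> omega
  have hpq : ∀ r, r < 2 * k + 1 → p r ≠ q r := by
    intro r hr; simp only [p, q]; split_ifs <;> omega
  have hip : ∀ r, r < 2 * k + 1 → idx (p r) = r := by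
    intro r hr; simp only [p, idx]; split_ifs <;> omega
  have hiq : ∀ r, r < 2 * k + 1 → idx (q r) = r := by
    intro r hr; simp only [q, idx]; split_ifs <;> omega
  have hidx : ∀ v, v < 2 * (2 * k + 1) →
      idx v < 2 * k + 1 ∧ (v = p (idx v) ∨ v = q (idx v)) := by
    intro v hv; simp only [p, q, idx]; split_ifs <;> omega
  let P : Fin (2 * k + 1) → Fin n := fun r => ⟨p r, (hplt r r.2).trans_le hn⟩
  let Q : Fin (2 * k + 1) → Fin n := fun r => ⟨q r, (hqlt r r.2).trans_le hn⟩
  let E : Fin (2 * k + 1) → KEdge n := fun r =>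
    ⟨s(P r, Q r), by simpa [P, Q, Fin.ext_iff] using hpq r r.2⟩
  have hmemE : ∀ r v, v ∈ (E r : Sym2 (Fin n)) ↔ v = P r ∨ v = Q r := fun r v => Sym2.mem_iff
  have hEidx : ∀ r v, v ∈ (E r : Sym2 (Fin n)) → idx v = r := by
    intro r v hv
    rcases (hmemE r v).1 hv with rfl | rfl
    · exact hip r r.2
    · exact hiq r r.2
  have hEinj : Function.Injective E := by
    intro r r' h
    apply Fin.ext
    rw [← hEidx r (P r) ((hmemE r _).2 (Or.inl rfl)), hEidx r' (P r) (h ▸ (hmemE r _).2 (Or.inl rfl))]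
  let ty : ℕ → Sym2 (Fin 3) := fun r =>
    if r < 2 * t + 1 then s(0, 1) else if r % 2 = 1 then s(0, 0) else s(1, 1)
  have hty : ∀ r, edgeType (nodeSide n (2 * k + 1)) (E r) = ty r := by
    intro r
    have hr := r.2
    have h1 : edgeType (nodeSide n (2 * k + 1)) (E r) =
        s(nodeSide n (2 * k + 1) (P r), nodeSide n (2 * k + 1) (Q r)) := rfl
    rw [h1]
    simp only [nodeSide, P, Q, p, q, ty]
    by_cases h2 : (r : ℕ) < 2 * t + 1
    · simp only [if_pos h2]
      rw [if_pos (by omega), if_neg (by omega), if_pos (by omega)]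
    · by_cases h3 : (r : ℕ) % 2 = 1
      · simp only [if_neg h2, if_pos h3]
        rw [if_pos (by omega), if_pos (by omega)]
      · simp only [if_neg h2, if_neg h3]
        rw [if_neg (by omega), if_pos (by omega), if_neg (by omega), if_pos (by omega)]
  refine ⟨Finset.univ.image E, mem_typedMatchings.2 ⟨?_, fun v => ?_, fun τ => ?_⟩⟩
  · intro e he f hf hef v hv
    obtain ⟨r, -, rfl⟩ := Finset.mem_image.1 he
    obtain ⟨r', -, rfl⟩ := Finset.mem_image.1 hf
    refine hef (congrArg E (Fin.ext ?_))
    rw [← hEidx r v hv.1, hEidx r' v hv.2]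
  · have hside : nodeSide n (2 * k + 1) v ≠ 2 ↔ (v : ℕ) < 2 * (2 * k + 1) := by
      unfold nodeSide
      split_ifs with h1 h2
      · exact iff_of_true (by decide) (by omega)
      · exact iff_of_true (by decide) h2
      · exact iff_of_false (by simp) h2
    rw [hside]
    constructor
    · rintro ⟨e, he, hv⟩
      obtain ⟨r, -, rfl⟩ := Finset.mem_image.1 he
      rcases (hmemE r v).1 hv with rfl | rfl
      · exact hplt r r.2
      · exact hqlt r r.2
    · intro hv
      obtain ⟨h1, h2⟩ := hidx v hv
      refine ⟨E ⟨idx v, h1⟩, Finset.mem_image_of_mem _ (Finset.mem_univ _), ?_⟩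
      rw [hmemE]
      exact h2.imp Fin.ext Fin.ext
  · have h1 : edgesOfType (nodeSide n (2 * k + 1)) τ (Finset.univ.image E) =
        (Finset.univ.filter fun r : Fin (2 * k + 1) => ty r = τ).image E := by
      ext e
      simp only [mem_edgesOfType, Finset.mem_image, Finset.mem_filter, Finset.mem_univ, true_and]
      constructor
      · rintro ⟨⟨r, rfl⟩, h⟩
        exact ⟨r, (hty r).symm.trans h, rfl⟩
      · rintro ⟨r, h, rfl⟩
        exact ⟨⟨r, rfl⟩, (hty r).trans h⟩
    rw [h1, Finset.card_image_of_injective _ hEinj]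
    have count : ∀ (c : ℕ) (f : ℕ → ℕ), Function.Injective f →
        (∀ u < c, f u < 2 * k + 1 ∧ ty (f u) = τ) →
        (∀ r < 2 * k + 1, ty r = τ → ∃ u < c, f u = r) →
        (Finset.univ.filter fun r : Fin (2 * k + 1) => ty r = τ).card = c := by
      intro c f hf h2 h3
      conv_rhs => rw [← Finset.card_range c]
      symm
      refine Finset.card_bij (fun u hu => ⟨f u, (h2 u (Finset.mem_range.1 hu)).1⟩) ?_ ?_ ?_
      · intro u hu
        simpa using (h2 u (Finset.mem_range.1 hu)).2
      · intro u _ u' _ h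
        exact hf (Fin.mk.inj h)
      · intro r hr
        obtain ⟨u, hu, hur⟩ := h3 r r.2 (Finset.mem_filter.1 hr).2
        exact ⟨u, Finset.mem_range.2 hu, Fin.ext hur⟩
    have ne1 : (s(0, 0) : Sym2 (Fin 3)) ≠ s(0, 1) := by decide
    have ne2 : (s(1, 1) : Sym2 (Fin 3)) ≠ s(0, 1) := by decide
    have ne3 : (s(1, 1) : Sym2 (Fin 3)) ≠ s(0, 0) := by decide
    unfold typeCount
    split_ifs with h2 h3
    · subst h2
      refine count _ id Function.injective_id (fun u hu => ⟨?_, ?_⟩) fun r hr h => ?_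
      · simp only [id]; omega
      · exact if_pos hu
      · refine ⟨r, ?_, rfl⟩
        by_contra h4
        simp only [ty, if_neg h4] at h
        split_ifs at h with h5
        · exact ne1 h
        · exact ne2 h
    · rcases h3 with rfl | rfl
      · refine count _ (fun u => 2 * (t + u) + 1) (fun u u' h => by simp only at h; omega)
          (fun u hu => ⟨by omega, ?_⟩) fun r hr h => ?_
        · simp only [ty]
          rw [if_neg (by omega), if_pos (by omega)]
        · simp only [ty] at h
          split_ifs at h with h4 h5
          · exact absurd h.symm ne1
          · exact ⟨(r - 1) / 2 - t, by omega, by omega⟩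
          · exact absurd h ne3
      · refine count _ (fun u => 2 * (t + u) + 2) (fun u u' h => by simp only at h; omega)
          (fun u hu => ⟨by omega, ?_⟩) fun r hr h => ?_
        · simp only [ty]
          rw [if_neg (by omega), if_neg (by omega)]
        · simp only [ty] at h
          split_ifs at h with h4 h5
          · exact absurd h.symm ne2
          · exact absurd h.symm ne3
          · exact ⟨(r - 2) / 2 - t, by omega, by omega⟩
    · rw [Finset.card_eq_zero, Finset.filter_eq_empty_iff]
      intro r _ h
      simp only [ty] at h
      split_ifs at h
      · exact h2 h.symm
      · exact h3 (Or.inl h.symm)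
      · exact h3 (Or.inr h.symm)

/-! ### Extrapolation and the odd-set inequalities -/

/-- Lagrange interpolation at `0, ..., k` is exact up to degree `k`. The weights may be negative, so
extrapolation does not preserve nonnegativity by itself. -/
theorem exists_extrapolation_weights (k : ℕ) (x : ℝ) :
    ∃ ν : ℕ → ℝ, ∀ q : Polynomial ℝ, q.natDegree ≤ k →
      ∑ t ∈ Finset.range (k + 1), ν t * q.eval (t : ℝ) = q.eval x := by
  refine ⟨fun t => (Lagrange.basis (Finset.range (k + 1)) (fun t : ℕ => (t : ℝ)) t).eval x,
    fun q hq => ?_⟩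
  have h1 := Lagrange.eq_interpolate (s := Finset.range (k + 1)) (v := fun t : ℕ => (t : ℝ))
    (f := q) (fun a _ b _ h => Nat.cast_injective h) ?_
  · conv_rhs => rw [h1, Lagrange.interpolate_apply, Polynomial.eval_finsetSum]
    refine Finset.sum_congr rfl fun t _ => ?_
    rw [Polynomial.eval_mul, Polynomial.eval_C, mul_comm]
  · rw [Finset.card_range]
    exact (Polynomial.degree_le_of_natDegree_le hq).trans_lt (by exact_mod_cast Nat.lt_succ_self k)

open Classical in
theorem two_mul_card_le_of_forall_mem {n : ℕ} {A : Finset (Fin n)} {N : Finset (KEdge n)}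
    (hN : IsEdgeMatching N) (hA : ∀ e ∈ N, ∀ v ∈ (e : Sym2 (Fin n)), v ∈ A) :
    2 * N.card ≤ A.card := by
  have h1 : (N.biUnion fun e => (e : Sym2 (Fin n)).toFinset).card = 2 * N.card := by
    rw [Finset.card_biUnion]
    · rw [Finset.sum_congr rfl (g := fun _ => 2), Finset.sum_const, smul_eq_mul, mul_comm]
      intro e _
      refine Sym2.card_toFinset_of_not_isDiag _ ?_
      obtain ⟨a, b, hab, he⟩ := e.exists_eq
      rw [he]
      simpa using hab
    · intro e he f hf hef
      refine Finset.disjoint_left.2 ?_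
      intro v hv hv'
      exact hN e he f hf hef v ⟨Sym2.mem_toFinset.1 hv, Sym2.mem_toFinset.1 hv'⟩
  rw [← h1]
  refine Finset.card_le_card fun v hv => ?_
  obtain ⟨e, he, hve⟩ := Finset.mem_biUnion.1 hv
  exact hA e he v (Sym2.mem_toFinset.1 hve)

/-- The number of edges with both ends in the first or both ends in the second half of the first
`2 * (2 * k + 1)` nodes, as a linear functional. -/
noncomputable def insideWeight (n k : ℕ) : (KEdge n → ℝ) →ₗ[ℝ] ℝ :=
  (∑ e ∈ edgesOfType (nodeSide n (2 * k + 1)) s(0, 0) Finset.univ, LinearMap.proj e) +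
    ∑ e ∈ edgesOfType (nodeSide n (2 * k + 1)) s(1, 1) Finset.univ, LinearMap.proj e

theorem insideWeight_charVec {n k : ℕ} (M : Finset (KEdge n)) :
    insideWeight n k (charVec M) = (edgesOfType (nodeSide n (2 * k + 1)) s(0, 0) M).card +
      (edgesOfType (nodeSide n (2 * k + 1)) s(1, 1) M).card := by
  classical
  have h : ∀ τ, ∑ e ∈ edgesOfType (nodeSide n (2 * k + 1)) τ Finset.univ, charVec M e =
      (edgesOfType (nodeSide n (2 * k + 1)) τ M).card := by
    intro τ
    simp only [charVec, Set.indicator_apply, Pi.one_apply, Finset.mem_coe]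
    rw [Finset.sum_boole]
    congr 2
    ext e
    simp [mem_edgesOfType, and_comm]
  simp [insideWeight, LinearMap.sum_apply, h]

theorem card_filter_nodeSide_le {n l : ℕ} (i : Fin 3) (hi : i ≠ 2) :
    (Finset.univ.filter fun v : Fin n => nodeSide n l v = i).card ≤ l := by
  have key : ∀ c : ℕ, (∀ v : Fin n, nodeSide n l v = i → c ≤ (v : ℕ) ∧ (v : ℕ) < c + l) →
      (Finset.univ.filter fun v : Fin n => nodeSide n l v = i).card ≤ l := by
    intro c h
    calc _ ≤ (Finset.Ico c (c + l)).card := by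
          refine Finset.card_le_card_of_injOn (fun v : Fin n => (v : ℕ)) (fun v hv => ?_)
            (fun v _ v' _ h => Fin.ext h)
          exact Finset.mem_coe.2 (Finset.mem_Ico.2 (h v (Finset.mem_filter.1 hv).2))
      _ = l := by simp
  fin_cases i
  · refine key 0 fun v hv => ?_
    unfold nodeSide at hv
    split_ifs at hv with h1 h2
    · omega
    · exact absurd hv (by decide)
    · exact absurd hv (by decide)
  · refine key l fun v hv => ?_
    unfold nodeSide at hv
    split_ifs at hv with h1 h2
    · exact absurd hv (by decide)
    · omega
    · exact absurd hv (by decide)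
  · exact absurd rfl hi

/-- Parity enters here: a half has at most `2 * k + 1` nodes, and its inside edges use an even
number of them. -/
theorem card_edgesOfType_side_le {n k : ℕ} {M : Finset (KEdge n)} (hM : IsEdgeMatching M)
    (i : Fin 3) (hi : i ≠ 2) :
    (edgesOfType (nodeSide n (2 * k + 1)) s(i, i) M).card ≤ k := by
  have h1 := two_mul_card_le_of_forall_mem
    (A := Finset.univ.filter fun v : Fin n => nodeSide n (2 * k + 1) v = i)
    (N := edgesOfType (nodeSide n (2 * k + 1)) s(i, i) M)
    (fun e he f hf => hM e (mem_edgesOfType.1 he).1 f (mem_edgesOfType.1 hf).1) ?_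
  · have h2 := card_filter_nodeSide_le (n := n) (l := 2 * k + 1) i hi
    omega
  · intro e he v hv
    have h2 := (mem_edgesOfType.1 he).2
    obtain ⟨b, -, hb⟩ := e.exists_eq_of_mem hv
    rw [edgeType, hb, Sym2.map_mk, Sym2.eq_iff] at h2
    simp only [Finset.mem_filter, Finset.mem_univ, true_and]
    tauto

/-- The two odd-set inequalities. -/
theorem insideWeight_le {n k : ℕ} {x : KEdge n → ℝ} (hx : x ∈ matchingPolytope (2 * k + 1) n) :
    insideWeight n k x ≤ 2 * k := by
  have hconv : Convex ℝ {x : KEdge n → ℝ | insideWeight n k x ≤ 2 * k} :=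
    convex_halfSpace_le (insideWeight n k).isLinear _
  refine convexHull_min ?_ hconv hx
  rintro _ ⟨M, hM, rfl⟩
  rw [Set.mem_ofPred_eq, insideWeight_charVec]
  have h0 := card_edgesOfType_side_le (k := k) hM.1 0 (by decide)
  have h1 := card_edgesOfType_side_le (k := k) hM.1 1 (by decide)
  have h2 : (edgesOfType (nodeSide n (2 * k + 1)) s(0, 0) M).card +
      (edgesOfType (nodeSide n (2 * k + 1)) s(1, 1) M).card ≤ 2 * k := by omega
  exact_mod_cast h2

theorem insideWeight_charVec_of_mem {n k t : ℕ} (ht : t ≤ k) {M : Finset (KEdge n)}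
    (hM : M ∈ crossingMatchings n k t) :
    insideWeight n k (charVec M) = 2 * ((k : ℝ) - t) := by
  have h := (mem_typedMatchings.1 hM).2.2
  have ne1 : (s(0, 0) : Sym2 (Fin 3)) ≠ s(0, 1) := by decide
  have ne2 : (s(1, 1) : Sym2 (Fin 3)) ≠ s(0, 1) := by decide
  rw [insideWeight_charVec, h, h]
  simp only [typeCount, ne1, ne2, if_false, true_or, or_true, if_true]
  rw [Nat.cast_sub ht]
  ring

open Polynomial in
/-- Extrapolation to crossing number zero: the weights `ν` turn the averages of a nonnegative
function that only depends on the edges at a small node set into a nonnegative number. -/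
theorem sum_average_nonneg {n k : ℕ} {ν : ℕ → ℝ}
    (hν : ∀ q : ℝ[X], q.natDegree ≤ k →
      ∑ t ∈ Finset.range (k + 1), ν t * q.eval (t : ℝ) = q.eval (-1 / 2))
    {f : Finset (KEdge n) → ℝ} {W : Finset (Fin n)} (hW : W.card ≤ k)
    (hne : ∀ t ≤ k, (crossingMatchings n k t).Nonempty)
    (hf0 : ∀ t ≤ k, ∀ M ∈ crossingMatchings n k t, 0 ≤ f M)
    (hf : ∀ t ≤ k, ∀ M ∈ crossingMatchings n k t, ∀ t' ≤ k, ∀ M' ∈ crossingMatchings n k t',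
      edgesMeeting W M = edgesMeeting W M' → f M = f M') :
    0 ≤ ∑ t ∈ Finset.range (k + 1), ν t *
      (((crossingMatchings n k t).card : ℝ)⁻¹ * ∑ M ∈ crossingMatchings n k t, f M) := by
  classical
  set 𝓐 := (Finset.range (k + 1)).biUnion fun t => crossingMatchings n k t with h𝓐
  have hmem𝓐 : ∀ M, M ∈ 𝓐 ↔ ∃ t ≤ k, M ∈ crossingMatchings n k t := by
    intro M
    simp [h𝓐]
  set 𝓕 := 𝓐.image (edgesMeeting W) with h𝓕
  have hrep : ∀ F, ∃ M, F ∈ 𝓕 → M ∈ 𝓐 ∧ edgesMeeting W M = F := by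
    intro F
    by_cases hF : F ∈ 𝓕
    · obtain ⟨M, h1, h2⟩ := Finset.mem_image.1 hF
      exact ⟨M, fun _ => ⟨h1, h2⟩⟩
    · exact ⟨∅, fun h => absurd h hF⟩
  choose R hR using hrep
  -- The edge counts as polynomials in `t`. At `-1/2` the crossing count is zero, and the inside
  -- counts are `k + 1/2`, above every actual count `k - t`.
  let P : Sym2 (Fin 3) → ℝ[X] := fun τ => if τ = s(0, 1) then C 2 * X + C 1 else
    if τ = s(0, 0) ∨ τ = s(1, 1) then C (k : ℝ) - X else 0
  have hpoly : ∀ F ∈ 𝓕, ∃ q : ℝ[X], q.natDegree ≤ F.card ∧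
      (∀ t ∈ Set.Iic k, ((membersContaining (crossingMatchings n k t) F).card : ℝ) =
        (crossingMatchings n k t).card * q.eval (t : ℝ)) ∧
      0 ≤ q.eval (-1 / 2) ∧
      ((∃ f ∈ F, (P (edgeType (nodeSide n (2 * k + 1)) f)).eval (-1 / 2) = 0) →
        q.eval (-1 / 2) = 0) := by
    intro F hF
    refine exists_polynomial_card_membersContaining (P := P) (m := typeCount k) ?_ ?_ ?_ F ?_
    · intro τ
      simp only [P]
      split_ifs
      · exact natDegree_linear_le
      · exact (natDegree_sub_le _ _).trans (by simp)
      · simp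
    · intro t ht τ
      simp only [P, typeCount]
      split_ifs
      · simp
      · simp [Nat.cast_sub (Set.mem_Iic.1 ht)]
      · simp
    · intro t ht τ
      simp only [P, typeCount]
      split_ifs
      · left
        simp only [eval_add, eval_mul, eval_C, eval_X]
        norm_num
      · right
        rw [Nat.cast_sub (Set.mem_Iic.1 ht)]
        simp only [eval_sub, eval_C, eval_X]
        have : (0 : ℝ) ≤ t := Nat.cast_nonneg t
        linarith
      · left
        simp
    · obtain ⟨h1, h2⟩ := hR F hF
      obtain ⟨t, ht, hM⟩ := (hmem𝓐 _).1 h1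
      refine ⟨t, ht, R F, hM, ?_⟩
      conv_lhs => rw [← h2]
      exact Finset.filter_subset _ _
  choose! q hq1 hq2 hq3 _ using hpoly
  have hcardF : ∀ F ∈ 𝓕, F.card ≤ k := by
    intro F hF
    obtain ⟨h1, h2⟩ := hR F hF
    obtain ⟨t, ht, hM⟩ := (hmem𝓐 _).1 h1
    rw [← h2]
    exact (card_edgesMeeting_le W (mem_typedMatchings.1 hM).1).trans hW
  -- All crossing matchings cover the same nodes, so a realized trace `F` contained in `M` already
  -- accounts for every covered node of `W`.
  have hiff : ∀ t ≤ k, ∀ M ∈ crossingMatchings n k t, ∀ F ∈ 𝓕,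
      edgesMeeting W M = F ↔ F ⊆ M := by
    intro t ht M hM F hF
    obtain ⟨h1, h2⟩ := hR F hF
    obtain ⟨t', ht', hM'⟩ := (hmem𝓐 _).1 h1
    obtain ⟨hmat, hcov, -⟩ := mem_typedMatchings.1 hM
    obtain ⟨hmat', hcov', -⟩ := mem_typedMatchings.1 hM'
    constructor
    · rintro rfl
      exact Finset.filter_subset _ _
    · intro hFM
      rw [← h2] at hFM ⊢
      ext e
      constructor
      · intro he
        obtain ⟨heM, v, hvW, hve⟩ := Finset.mem_filter.1 he
        obtain ⟨e', he', hve'⟩ := (hcov' v).2 ((hcov v).1 ⟨e, heM, hve⟩)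
        have h3 : e' ∈ edgesMeeting W (R F) := Finset.mem_filter.2 ⟨he', v, hvW, hve'⟩
        rwa [hmat.eq_of_mem heM (hFM h3) hve hve']
      · intro he
        exact Finset.mem_filter.2 ⟨hFM he, (Finset.mem_filter.1 he).2⟩
  have hsum : ∀ t ≤ k, ((crossingMatchings n k t).card : ℝ)⁻¹ *
      ∑ M ∈ crossingMatchings n k t, f M = ∑ F ∈ 𝓕, f (R F) * (q F).eval (t : ℝ) := by
    intro t ht
    have hc : ((crossingMatchings n k t).card : ℝ) ≠ 0 := by
      exact_mod_cast (Finset.card_pos.2 (hne t ht)).ne'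
    rw [← Finset.sum_fiberwise_of_maps_to (t := 𝓕) (g := edgesMeeting W)
      (fun M hM => Finset.mem_image_of_mem _ ((hmem𝓐 M).2 ⟨t, ht, hM⟩)), Finset.mul_sum]
    refine Finset.sum_congr rfl fun F hF => ?_
    have h1 : (crossingMatchings n k t).filter (fun M => edgesMeeting W M = F) =
        membersContaining (crossingMatchings n k t) F := by
      ext M
      rw [Finset.mem_filter, mem_membersContaining]
      exact and_congr_right fun hM => hiff t ht M hM F hF
    have h2 : ∀ M ∈ (crossingMatchings n k t).filter (fun M => edgesMeeting W M = F),
        f M = f (R F) := by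
      intro M hM
      obtain ⟨h3, h4⟩ := Finset.mem_filter.1 hM
      obtain ⟨h5, h6⟩ := hR F hF
      obtain ⟨t', ht', hM'⟩ := (hmem𝓐 _).1 h5
      exact hf t ht M h3 t' ht' _ hM' (h4.trans h6.symm)
    rw [Finset.sum_congr rfl h2, Finset.sum_const, h1, nsmul_eq_mul, hq2 F hF t ht]
    field_simp
  have htotal : ∑ t ∈ Finset.range (k + 1), ν t *
      (((crossingMatchings n k t).card : ℝ)⁻¹ * ∑ M ∈ crossingMatchings n k t, f M) =
      ∑ F ∈ 𝓕, f (R F) * (q F).eval (-1 / 2) := by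
    rw [Finset.sum_congr rfl fun t ht => by
      rw [hsum t (Nat.lt_succ_iff.1 (Finset.mem_range.1 ht)), Finset.mul_sum], Finset.sum_comm]
    refine Finset.sum_congr rfl fun F hF => ?_
    rw [← hν (q F) ((hq1 F hF).trans (hcardF F hF)), Finset.mul_sum]
    exact Finset.sum_congr rfl fun t _ => by ring
  rw [htotal]
  refine Finset.sum_nonneg fun F hF => mul_nonneg ?_ (hq3 F hF)
  obtain ⟨t, ht, hM⟩ := (hmem𝓐 _).1 (hR F hF).1
  exact hf0 t ht _ hM

/-! ### Dimension count for six nodes -/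

theorem linearIndependent_of_triangular {m : ℕ} {B : Type*} {v : Fin m → B → ℝ} {e : Fin m → B}
    (h1 : ∀ i, v i (e i) = 1) (h0 : ∀ i j, i < j → v i (e j) = 0) : LinearIndependent ℝ v := by
  have hdet : (Matrix.of fun i j => v i (e j)).det ≠ 0 := by
    have htri : (Matrix.of fun i j => v i (e j)).IsLowerTriangular :=
      fun i j hij => h0 i j (by simpa using hij)
    rw [Matrix.det_of_isLowerTriangular _ htri]
    simp [h1]
  exact LinearIndependent.of_comp (LinearMap.funLeft ℝ ℝ e)
    (Matrix.linearIndependent_rows_of_det_ne_zero hdet)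

/-- An affine image of `ℝ^d` contains at most `d + 1` linearly independent vectors. -/
theorem le_succ_of_linearIndependent_of_mem_range {m d : ℕ} {B : Type*} {v : Fin m → B → ℝ}
    (hv : LinearIndependent ℝ v) (p : (Fin d → ℝ) →ᵃ[ℝ] (B → ℝ))
    (hp : ∀ i, ∃ y, p y = v i) : m ≤ d + 1 := by
  choose y hy using hp
  let T : ((Fin d → ℝ) × ℝ) →ₗ[ℝ] (B → ℝ) :=
    p.linear.comp (LinearMap.fst ℝ _ _) + (LinearMap.snd ℝ _ _).smulRight (p 0)
  have hT : ∀ i, T (y i, 1) = v i := by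
    intro i
    rw [← hy i, congrFun p.decomp (y i)]
    simp [T]
  have hz : LinearIndependent ℝ fun i => ((y i, 1) : (Fin d → ℝ) × ℝ) := by
    refine LinearIndependent.of_comp T ?_
    have : (T ∘ fun i => ((y i, 1) : (Fin d → ℝ) × ℝ)) = v := funext hT
    rwa [this]
  simpa using hz.fintype_card_le_finrank

/-- The edge of the complete graph on six nodes with two given ends. -/
def sixEdge (a b : Fin 6) (h : a ≠ b) : KEdge 6 := ⟨s(a, b), by simpa using h⟩

/-- The perfect matchings of the complete graph on six nodes span a space of dimension at least
eight. -/
theorem exists_linearIndependent_matchings_six :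
    ∃ M : Fin 8 → Finset (KEdge 6), (∀ i, M i ∈ matchingsOfSize 3 6) ∧
      LinearIndependent ℝ fun i => charVec (M i) := by
  let E : Fin 6 → Fin 6 → KEdge 6 := fun a b =>
    if h : a ≠ b then sixEdge a b h else sixEdge 0 1 (by decide)
  let M : Fin 8 → Finset (KEdge 6) := ![
    {E 0 1, E 2 3, E 4 5}, {E 0 1, E 2 4, E 3 5}, {E 0 1, E 2 5, E 3 4}, {E 0 2, E 1 3, E 4 5},
    {E 0 2, E 1 4, E 3 5}, {E 0 2, E 1 5, E 3 4}, {E 0 3, E 1 2, E 4 5}, {E 0 4, E 1 2, E 3 5}]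
  -- The edge `e i` lies in `M i` and in no earlier matching, which makes the incidence matrix
  -- triangular.
  let e : Fin 8 → KEdge 6 := ![E 0 1, E 2 4, E 2 5, E 0 2, E 1 4, E 1 5, E 0 3, E 0 4]
  refine ⟨M, fun i => ⟨?_, ?_⟩, linearIndependent_of_triangular (e := e) ?_ ?_⟩
  · unfold IsEdgeMatching
    revert i
    decide
  · revert i
    decide
  · have h : ∀ i, e i ∈ M i := by decide
    intro i
    simp [charVec, h i]
  · have h : ∀ i j, i < j → e j ∉ M i := by decide
    intro i j hij
    simp [charVec, h i j hij]

/-- No symmetry is needed. The case is exceptional because the symmetric group on six points has an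
exotic transitive subgroup of index 6, the value of `Nat.choose 6 1`. -/
theorem six_lt_of_isSubspaceExtension {d : ℕ} {Q : Set (Fin d → ℝ)}
    {p : (Fin d → ℝ) →ᵃ[ℝ] (KEdge 6 → ℝ)}
    (hext : IsSubspaceExtension (matchingPolytope 3 6) Q p) : 6 < d := by
  obtain ⟨M, hM, hlin⟩ := exists_linearIndependent_matchings_six
  have h := le_succ_of_linearIndependent_of_mem_range hlin p fun i => by
    have h1 : charVec (M i) ∈ p '' Q := by
      rw [hext.2]
      exact subset_convexHull ℝ _ (Set.mem_image_of_mem _ (hM i))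
    obtain ⟨y, -, hy⟩ := h1
    exact ⟨y, hy⟩
  omega

/-! ### The contradiction -/

/-- Nonconstancy of sections over the single edges. -/
theorem exists_even_perm_section_ne {n d : ℕ} (hn : 3 ≤ n) {s : Finset (KEdge n) → Fin d → ℝ}
    {p : (Fin d → ℝ) →ᵃ[ℝ] (KEdge n → ℝ)}
    (hs : ∀ M ∈ matchingsOfSize 1 n, p (s M) = charVec M) :
    ∃ g : Equiv.Perm (Fin n), Equiv.Perm.sign g = 1 ∧ ∃ M, s (mapEdges g M) ≠ s M := by
  let a : Fin n := ⟨0, by omega⟩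
  let b : Fin n := ⟨1, by omega⟩
  let c : Fin n := ⟨2, by omega⟩
  have hab : a ≠ b := by simp [a, b, Fin.ext_iff]
  have hbc : b ≠ c := by simp [b, c, Fin.ext_iff]
  have hac : a ≠ c := by simp [a, c, Fin.ext_iff]
  let e : KEdge n := ⟨s(a, b), by simpa using hab⟩
  let g := Equiv.swap a b * Equiv.swap b c
  have hM : ({e} : Finset (KEdge n)) ∈ matchingsOfSize 1 n := by
    refine ⟨fun f hf f' hf' h => ?_, Finset.card_singleton e⟩
    rw [Finset.mem_singleton] at hf hf'
    exact absurd (hf.trans hf'.symm) h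
  refine ⟨g, ?_, {e}, fun h => ?_⟩
  · rw [Equiv.Perm.sign_mul, Equiv.Perm.sign_swap hab, Equiv.Perm.sign_swap hbc]
    rfl
  · have h1 := congrArg p h
    rw [hs _ (mapEdges_mem_matchingsOfSize hM g), hs _ hM] at h1
    have h2 := congrFun h1 (edgePerm g e)
    have h3 : edgePerm g e ≠ e := by
      intro h4
      have h5 : c ∈ (edgePerm g e : Sym2 (Fin n)) := by
        rw [coe_edgePerm]
        refine Sym2.mem_map.2 ⟨b, by simp [e], ?_⟩
        simp only [g, Equiv.Perm.mul_apply, Equiv.swap_apply_left]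
        exact Equiv.swap_apply_of_ne_of_ne hac.symm hbc.symm
      rw [h4] at h5
      rcases Sym2.mem_iff.1 h5 with h6 | h6
      · exact hac h6.symm
      · exact hbc h6.symm
    have h4 : edgePerm g e ∈ mapEdges g {e} := edgePerm_mem_mapEdges.2 (Finset.mem_singleton_self e)
    simp [charVec, h4, h3] at h2

/-- A section whose components are invariant under all even permutations that fix few nodes yields
a point of the extension whose projection violates an odd-set inequality. -/
theorem not_forall_even_invariant {n d k : ℕ} (hk : 1 ≤ k) (hn : 2 * (2 * k + 1) ≤ n)
    {Q : Set (Fin d → ℝ)} {p : (Fin d → ℝ) →ᵃ[ℝ] (KEdge n → ℝ)}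
    (hext : IsSubspaceExtension (matchingPolytope (2 * k + 1) n) Q p)
    {s : Finset (KEdge n) → Fin d → ℝ}
    (hs : ∀ M ∈ matchingsOfSize (2 * k + 1) n, s M ∈ Q ∧ p (s M) = charVec M) :
    ¬ ∀ j, ∃ W : Finset (Fin n), W.card ≤ k ∧
      ∀ g : Equiv.Perm (Fin n), Equiv.Perm.sign g = 1 → (∀ a ∈ W, g a = a) →
        ∀ M, s (mapEdges g M) j = s M j := by
  intro hinv
  -- The point `-1/2` is the zero of the crossing number `2 * t + 1`.
  obtain ⟨ν, hν⟩ := exists_extrapolation_weights k (-1 / 2)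
  have hmem : ∀ t ≤ k, ∀ M ∈ crossingMatchings n k t, M ∈ matchingsOfSize (2 * k + 1) n :=
    fun t ht M hM => mem_matchingsOfSize_of_mem_crossingMatchings ht hM
  have hne : ∀ t ≤ k, (crossingMatchings n k t).Nonempty :=
    fun t ht => crossingMatchings_nonempty hn ht
  have hle : ∀ t ∈ Finset.range (k + 1), t ≤ k := fun t ht => Nat.lt_succ_iff.1 (Finset.mem_range.1 ht)
  obtain ⟨⟨L, hL⟩, himg⟩ := id hext
  have hw1 : ∑ t ∈ Finset.range (k + 1), ν t = 1 := by
    simpa using hν 1 (by simp)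
  have hw : ∀ t ≤ k, ∑ _M ∈ crossingMatchings n k t,
      ((crossingMatchings n k t).card : ℝ)⁻¹ = 1 := by
    intro t ht
    have hc : ((crossingMatchings n k t).card : ℝ) ≠ 0 := by
      exact_mod_cast (Finset.card_pos.2 (hne t ht)).ne'
    rw [Finset.sum_const, nsmul_eq_mul, mul_inv_cancel₀ hc]
  set avg : ℕ → Fin d → ℝ := fun t => ∑ M ∈ crossingMatchings n k t,
    ((crossingMatchings n k t).card : ℝ)⁻¹ • s M with havg
  have havgL : ∀ t ≤ k, avg t ∈ L := fun t ht =>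
    L.sum_smul_mem_of_sum_eq_one _ _ _ (hw t ht) fun M hM => by
      have h1 := (hs M (hmem t ht M hM)).1
      rw [hL] at h1
      exact h1.1
  set y : Fin d → ℝ := ∑ t ∈ Finset.range (k + 1), ν t • avg t with hy
  have hyL : y ∈ L := L.sum_smul_mem_of_sum_eq_one _ _ _ hw1 fun t ht => havgL t (hle t ht)
  have hy0 : ∀ j, 0 ≤ y j := by
    intro j
    obtain ⟨W, hW, hWinv⟩ := hinv j
    have h1 := sum_average_nonneg hν (f := fun M => s M j) hW hne
      (fun t ht M hM => by
        have h1 := (hs M (hmem t ht M hM)).1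
        rw [hL] at h1
        exact h1.2 j)
      (fun t ht M hM t' ht' M' hM' hMM' => by
        obtain ⟨hmat, hcov, -⟩ := mem_typedMatchings.1 hM
        obtain ⟨hmat', hcov', -⟩ := mem_typedMatchings.1 hM'
        have hcard := (hmem t' ht' M' hM').2
        obtain ⟨g, hg1, hg2, hg3⟩ := exists_even_perm_mapEdges_eq W hmat hmat' (by omega)
          (fun v => (hcov v).trans (hcov' v).symm) hMM'
        rw [← hg3]
        exact (hWinv g hg1 hg2 M).symm)
    have h2 : y j = ∑ t ∈ Finset.range (k + 1), ν t *
        (((crossingMatchings n k t).card : ℝ)⁻¹ * ∑ M ∈ crossingMatchings n k t, s M j) := by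
      simp only [hy, havg, Finset.sum_apply, Pi.smul_apply, smul_eq_mul, Finset.mul_sum]
    rw [h2]
    exact h1
  have hyQ : y ∈ Q := by
    rw [hL]
    exact ⟨hyL, hy0⟩
  have hpy : p y ∈ matchingPolytope (2 * k + 1) n := by
    rw [← himg]
    exact Set.mem_image_of_mem _ hyQ
  have h1 := insideWeight_le hpy
  have h2 : ∀ t ≤ k, insideWeight n k (p (avg t)) = 2 * ((k : ℝ) - t) := by
    intro t ht
    rw [havg, p.map_sum_smul_of_sum_eq_one _ _ _ (hw t ht), map_sum]
    rw [Finset.sum_congr rfl (g := fun _ => ((crossingMatchings n k t).card : ℝ)⁻¹ *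
      (2 * ((k : ℝ) - t)))]
    · rw [← Finset.sum_mul, hw t ht, one_mul]
    · intro M hM
      rw [map_smul, smul_eq_mul, (hs M (hmem t ht M hM)).2, insideWeight_charVec_of_mem ht hM]
  have h3 : insideWeight n k (p y) = 2 * k + 1 := by
    rw [hy, p.map_sum_smul_of_sum_eq_one _ _ _ hw1, map_sum]
    -- The inside weight `2 * (k - t)` has degree one, within reach of the weights because `k ≥ 1`;
    -- at `-1/2` it equals `2 * k + 1`.
    have h4 := hν (Polynomial.C 2 * (Polynomial.C (k : ℝ) - Polynomial.X)) ?_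
    · simp only [Polynomial.eval_mul, Polynomial.eval_sub, Polynomial.eval_C,
        Polynomial.eval_X] at h4
      rw [Finset.sum_congr rfl fun t ht => by
        rw [map_smul, smul_eq_mul, h2 t (hle t ht)], h4]
      ring
    · refine (Polynomial.natDegree_C_mul_le _ _).trans ?_
      refine (Polynomial.natDegree_sub_le _ _).trans ?_
      simpa using hk
  linarith

theorem theorem3p1 (n l : ℕ) (hn : 3 ≤ n) (hodd : Odd l) (hl : 2 * l ≤ n) :
    ¬ ∃ (d : ℕ) (Q : Set (Fin d → ℝ)) (p : (Fin d → ℝ) →ᵃ[ℝ] (KEdge n → ℝ)),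
      d ≤ n.choose ((l - 1) / 2) ∧
      IsSubspaceExtension (matchingPolytope l n) Q p ∧
      IsCoordinateSymmetric (nodePermGroup n) Q p := by
  rintro ⟨d, Q, p, hd, hext, hsym⟩
  obtain ⟨k, rfl⟩ := hodd
  rw [show (2 * k + 1 - 1) / 2 = k by omega] at hd
  obtain ⟨s, hs, hequiv⟩ := exists_equivariant_section hext hsym
  by_cases h6 : k = 0 ∨ 7 ≤ n
  · have hinv := exists_finset_forall_even_invariant hequiv hd (by omega) h6
    rcases Nat.eq_zero_or_pos k with rfl | hk
    · obtain ⟨g, hg, M, hM⟩ := exists_even_perm_section_ne hn fun M hM => (hs M hM).2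
      refine hM (funext fun j => ?_)
      obtain ⟨W, hW, hWinv⟩ := hinv j
      rw [Nat.le_zero, Finset.card_eq_zero] at hW
      subst hW
      exact hWinv g hg (by simp) M
    · exact not_forall_even_invariant hk hl hext hs hinv
  -- With `k ≥ 1` and `4 * k + 2 ≤ n < 7`, only this case is left.
  · obtain rfl : n = 6 := by omega
    obtain rfl : k = 1 := by omega
    have h1 := six_lt_of_isSubspaceExtension hext
    have h2 : Nat.choose 6 1 = 6 := by decide
    omega
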